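/- Let $\mathbb K$ be a field and let $E=(E^0,E^1,r,s)$ be a directed graph (with range and source maps $r,s:E^1\to E^0$) that has at least one edge. Let $\mathbb F$ be the free group on $E^1$, with identity $e$. Let $L_{\mathbb K}(E)$ be the Leavitt path algebra, that is, the (not necessarily unital) associative $\mathbb K$-algebra generated by pairwise orthogonal idempotents $v\in E^0$ and elements $f,f^*$ ($f\in E^1$) subject to $s(f)f=fr(f)=f$, $r(f)f^*=f^*s(f)=f^*$, $f^*f'=\delta_{f,f'}r(f)$ for $f,f'\in E^1$, and $v=\sum_{s(f)=v}ff^*$ whenever $s^{-1}(v)$ is finite and non-empty. Let $W$ be the set of finite paths of non-zero length, and let $X$ be the set of all finite paths ending in a sink (including sinks themselves, as paths of length zero) and all infinite paths. For $g\in\mathbb F$ define $X_g\subseteq X$ by: $X_e=X$; $X_{b^{-1}}=\{\xi\in X: s(\xi)=r(b)\}$ for $b\in W$; $X_a=\{\xi\in X:\xi\text{ begins with }a\}$ for $a\in W$; $X_{ab^{-1}}=X_a$ for $a,b\in W$ with $r(a)=r(b)$ and $ab^{-1}$ reduced; $X_g=\emptyset$ for all other $g$. Let $\theta_g:X_{g^{-1}}\to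 X_g$ be the bijection $b\zeta\mapsto a\zeta$ when $g=ab^{-1}$ in reduced form, where $a$ or $b$ may have length zero (so that $\theta_e=\mathrm{id}$). Let $1_g$ and $1_v$ be the $\mathbb K$-valued characteristic functions on $X$ of $X_g$ and of $X_v=\{\xi\in X:s(\xi)=v\}$, let $D(X)$ be the $\mathbb K$-linear span of $\{1_g: g\in\mathbb F\setminus\{e\}\}\cup\{1_v:v\in E^0\}$, let $D_e=D(X)$ and $D_g=1_gD(X)$ for $g\ne e$, and let $\alpha_g:D_{g^{-1}}\to D_g$, $\alpha_g(h)=h\circ\theta_{g^{-1}}$ on $X_g$ (and $0$ off $X_g$). Then $\alpha=(D_g,\alpha_g)_{g\in\mathbb F}$ is a partial action of $\mathbb F$ on $D(X)$; let $D(X)\star_\alpha\mathbb F=\bigoplus_{g\in\mathbb F}D_g\delta_g$ be its partial skew group ring, with product $(x\delta_g)(y\delta_h)=\alpha_g(\alpha_{g^{-1}}(x)y)\delta_{gh}$. There is a unique isomorphism of $\mathbb K$-algebras $\varphi:L_{\mathbb K}(E)\to D(X)\star_\alpha\mathbb F$ with $\varphi(f)=1_f\delta_f$, $\varphi(f^*)=1_{f^{-1}}\delta_{f^{-1}}$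 for $f\in E^1$ and $\varphi(v)=1_v\delta_e$ for $v\in E^0$, and $L_{\mathbb K}(E)_g:=\varphi^{-1}(D_g\delta_g)$, $g\in\mathbb F$, is an $\mathbb F$-grading of $L_{\mathbb K}(E)$. For this grading the following assertions are equivalent: 1. $L_{\mathbb K}(E)$ is strongly graded, i.e. $L_{\mathbb K}(E)_g\,L_{\mathbb K}(E)_h=L_{\mathbb K}(E)_{gh}$ for all $g,h\in\mathbb F$, where the left side is the set of finite sums of products; 2. $L_{\mathbb K}(E)$ is graded clean, i.e. it is unital and every homogeneous element is the sum of a homogeneous unit and a homogeneous idempotent ($0$ being allowed as an idempotent); 3. $L_{\mathbb K}(E)$ is graded unit-regular, i.e. it is unital and every homogeneous element $x$ can be written as $x=xux$ with a homogeneous unit $u$; 4. $E$ consists of exactly one vertex and exactly one edge (a loop at that vertex). -/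

import Mathlib

universe u v w

/-! ### Graded rings (not assumed to be unital) -/

namespace GroupGraded

variable {G : Type*} {R : Type*} [Group G] [NonUnitalRing R]

open Classical in
/-- `R = ⨁ R_g` with `R_g R_h ⊆ R_{gh}`. -/
structure IsGrading (A : G → AddSubgroup R) : Prop where
  internal : DirectSum.IsInternal A
  mul_mem : ∀ (g h : G) (x y : R), x ∈ A g → y ∈ A h → x * y ∈ A (g * h)

/-- The grading is strong: `R_g R_h = R_{gh}`, where `R_g R_h` is the set of finite sums of
products. -/
def IsStronglyGraded (A : G → AddSubgroup R) : Prop :=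
  IsGrading A ∧
    ∀ g h : G, AddSubgroup.closure {z : R | ∃ x ∈ A g, ∃ y ∈ A h, z = x * y} = A (g * h)

/-- `e` is the (two-sided) unit of `R`. -/
def IsUnity (e : R) : Prop := ∀ x : R, e * x = x ∧ x * e = x

/-- `u` is invertible with respect to the unit `e`. -/
def IsInvertible (e u : R) : Prop := ∃ w : R, u * w = e ∧ w * u = e

/-- `x` lies in one of the components (`0` is allowed). -/
def IsHomogeneous (A : G → AddSubgroup R) (x : R) : Prop := ∃ g : G, x ∈ A g

/-- `R` is unital, and every homogeneous element is the sum of a homogeneous unit and a homogeneous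
idempotent. -/
def IsGradedClean (A : G → AddSubgroup R) : Prop :=
  IsGrading A ∧ ∃ e : R, IsUnity e ∧ ∀ x : R, IsHomogeneous A x →
    ∃ u a : R, IsHomogeneous A u ∧ IsInvertible e u ∧ IsHomogeneous A a ∧ a * a = a ∧ x = u + a

/-- `R` is unital, and every homogeneous `x` is `x u x` for some homogeneous unit `u`. -/
def IsGradedUnitRegular (A : G → AddSubgroup R) : Prop :=
  IsGrading A ∧ ∃ e : R, IsUnity e ∧ ∀ x : R, IsHomogeneous A x →
    ∃ u : R, IsHomogeneous A u ∧ IsInvertible e u ∧ x = x * u * x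

end GroupGraded

/-! ### Partial actions and partial skew group rings -/

/-- A partial action of the group `G` on the `K`-algebra `R`: ideals `D g` and isomorphisms of
`K`-algebras `α g : D g⁻¹ → D g`. -/
structure PartialAction (K : Type*) (G : Type*) (R : Type*) [CommRing K] [Group G]
    [NonUnitalRing R] [Module K R] where
  D : G → Submodule K R
  mul_mem_left : ∀ (g : G) (r x : R), x ∈ D g → r * x ∈ D g
  mul_mem_right : ∀ (g : G) (r x : R), x ∈ D g → x * r ∈ D g
  α : ∀ g : G, D g⁻¹ ≃ₗ[K] D g
  map_mul : ∀ (g : G) (x y : D g⁻¹),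
    (α g ⟨(x : R) * y, mul_mem_left _ _ _ y.2⟩ : R) = (α g x : R) * (α g y : R)
  D_one : D 1 = ⊤
  α_one : ∀ x : D (1 : G)⁻¹, (α 1 x : R) = x
  image_inter : ∀ g h : G,
    (fun x : D g⁻¹ => (α g x : R)) '' {x | (x : R) ∈ D h} = {y : R | y ∈ D g ∧ y ∈ D (g * h)}
  comp : ∀ (g h : G) (r : R) (hr : r ∈ D h⁻¹) (hr' : r ∈ D (g * h)⁻¹)
    (hm : (α h ⟨r, hr⟩ : R) ∈ D g⁻¹), (α g ⟨_, hm⟩ : R) = α (g * h) ⟨r, hr'⟩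

namespace PartialAction

variable {K : Type*} {G : Type*} {R : Type*} [CommRing K] [Group G]
  [NonUnitalRing R] [Module K R]

/-- An element of `D g`, regarded as an element of `D (g⁻¹)⁻¹`. -/
def toInvInv (P : PartialAction K G R) (g : G) : P.D g →ₗ[K] P.D (g⁻¹)⁻¹ :=
  Submodule.inclusion (by rw [inv_inv])

/-- The element `α_{g⁻¹}(r) r'` of `D g⁻¹ ∩ D h`, for `r ∈ D g` and `r' ∈ D h`. -/
def coeffArg (P : PartialAction K G R) (g h : G) (r : P.D g) (r' : P.D h) : P.D g⁻¹ :=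
  ⟨(P.α g⁻¹ (P.toInvInv g r) : R) * r', P.mul_mem_right _ _ _ (P.α g⁻¹ _).2⟩

/-- The coefficient `α_g (α_{g⁻¹}(r) r')` of `(r δ_g) (r' δ_h)`. -/
def coeffMul (P : PartialAction K G R) (g h : G) (r : P.D g) (r' : P.D h) : R :=
  P.α g (P.coeffArg g h r r')

theorem coeffMul_mem (P : PartialAction K G R) (g h : G) (r : P.D g) (r' : P.D h) :
    P.coeffMul g h r r' ∈ P.D (g * h) := by
  have : P.coeffMul g h r r' ∈
      (fun x : P.D g⁻¹ => (P.α g x : R)) '' {x | (x : R) ∈ P.D h} :=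
    ⟨P.coeffArg g h r r', P.mul_mem_left _ _ _ r'.2, rfl⟩
  rw [P.image_inter] at this
  exact this.2

variable [IsScalarTower K R R] [SMulCommClass K R R]

/-- The bilinear map `D g × D h → D (g h)` underlying the product of the partial skew group
ring. -/
def mulComponent (P : PartialAction K G R) (g h : G) : P.D g →ₗ[K] P.D h →ₗ[K] P.D (g * h) :=
  LinearMap.mk₂ K (fun r r' => ⟨P.coeffMul g h r r', P.coeffMul_mem g h r r'⟩)
    (fun a b c => by
      have : P.coeffArg g h (a + b) c = P.coeffArg g h a c + P.coeffArg g h b c :=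
        Subtype.ext (by simp [coeffArg, add_mul])
      exact Subtype.ext (by simp [coeffMul, this]))
    (fun k a c => by
      have : P.coeffArg g h (k • a) c = k • P.coeffArg g h a c :=
        Subtype.ext (by simp [coeffArg, smul_mul_assoc])
      exact Subtype.ext (by simp [coeffMul, this]))
    (fun a b c => by
      have : P.coeffArg g h a (b + c) = P.coeffArg g h a b + P.coeffArg g h a c :=
        Subtype.ext (by simp [coeffArg, mul_add])
      exact Subtype.ext (by simp [coeffMul, this]))
    (fun k a c => by
      have : P.coeffArg g h a (k • c) = k • P.coeffArg g h a c :=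
        Subtype.ext (by simp [coeffArg, mul_smul_comm])
      exact Subtype.ext (by simp [coeffMul, this]))

open DirectSum in
/-- The partial skew group ring: the direct sum of the `D g δ_g`. -/
def SkewGroupRing (P : PartialAction K G R) : Type _ := ⨁ g : G, P.D g

namespace SkewGroupRing

variable (P : PartialAction K G R)

noncomputable instance : AddCommGroup P.SkewGroupRing :=
  inferInstanceAs (AddCommGroup (DirectSum G fun g => P.D g))

noncomputable instance : Module K P.SkewGroupRing :=
  inferInstanceAs (Module K (DirectSum G fun g => P.D g))

open Classical in
/-- The element `r δ_g`, for `r ∈ D g`. -/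
noncomputable def single (g : G) : P.D g →ₗ[K] P.SkewGroupRing :=
  DirectSum.lof K G (fun g => P.D g) g

open Classical in
/-- The bilinear extension of `(r δ_g) (r' δ_h) = α_g (α_{g⁻¹}(r) r') δ_{gh}`. -/
noncomputable def mulMap : P.SkewGroupRing →ₗ[K] P.SkewGroupRing →ₗ[K] P.SkewGroupRing :=
  DirectSum.toModule K G _ fun g =>
    LinearMap.flip <| DirectSum.toModule K G _ fun h =>
      LinearMap.flip <| (P.mulComponent g h).compr₂ (single P (g * h))

noncomputable instance : Mul P.SkewGroupRing := ⟨fun a b => mulMap P a b⟩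

theorem mul_def (a b : P.SkewGroupRing) : a * b = mulMap P a b := rfl

noncomputable instance : NonUnitalNonAssocRing P.SkewGroupRing where
  left_distrib a b c := by simp only [mul_def, map_add]
  right_distrib a b c := by simp only [mul_def, map_add, LinearMap.add_apply]
  zero_mul a := by simp only [mul_def, map_zero, LinearMap.zero_apply]
  mul_zero a := by simp only [mul_def, map_zero]

theorem single_mul_single (g h : G) (r : P.D g) (r' : P.D h) :
    single P g r * single P h r' =
      single P (g * h) ⟨P.coeffMul g h r r', P.coeffMul_mem g h r r'⟩ := by
  classical
  simp only [mul_def, mulMap]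
  erw [DirectSum.toModule_lof, LinearMap.flip_apply, DirectSum.toModule_lof]
  rfl

/-- The homogeneous component `D g δ_g`. -/
noncomputable def component (g : G) : Submodule K P.SkewGroupRing := LinearMap.range (single P g)

end SkewGroupRing

end PartialAction

/-! ### Directed graphs and Leavitt path algebras -/

/-- A directed graph with vertex set `V`, edge set `E`, source map `s` and range map `r`. -/
structure DirectedGraph (V : Type u) (E : Type v) where
  s : E → V
  r : E → V

namespace DirectedGraph

variable {V : Type u} {E : Type v}

/-- The graph consists of a single vertex and a single loop. -/
def IsLoop (Γ : DirectedGraph V E) : Prop :=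
  ∃ (x : V) (e : E), (∀ y : V, y = x) ∧ (∀ f : E, f = e) ∧ Γ.s e = x ∧ Γ.r e = x

/-- A vertex that emits no edge. -/
def IsSink (Γ : DirectedGraph V E) (x : V) : Prop := ∀ f : E, Γ.s f ≠ x

/-- The generators of the Leavitt path algebra: vertices, edges and ghost edges. -/
inductive Gen (V : Type u) (E : Type v) : Type (max u v)
  | vertex : V → Gen V E
  | edge : E → Gen V E
  | ghost : E → Gen V E

/-- The free (associative, non-unital) `K`-algebra on the generators: the semigroup algebra of the
free semigroup. -/
abbrev FreeAlg (K : Type w) [Field K] (V : Type u) (E : Type v) : Type (max u v w) :=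
  MonoidAlgebra K (FreeSemigroup (Gen V E))

/-- A generator, as an element of the free algebra. -/
noncomputable def gen (K : Type w) [Field K] (x : Gen V E) : FreeAlg K V E :=
  MonoidAlgebra.single (FreeSemigroup.of x) 1

open Gen in
/-- The defining relations of the Leavitt path algebra. -/
inductive LeavittRel (K : Type w) [Field K] (Γ : DirectedGraph V E) :
    FreeAlg K V E → FreeAlg K V E → Prop
  | vertex_idem (x : V) :
      LeavittRel K Γ (gen K (vertex x) * gen K (vertex x)) (gen K (vertex x))
  | vertex_orth (x y : V) : x ≠ y →
      LeavittRel K Γ (gen K (vertex x) * gen K (vertex y)) 0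
  | source_edge (f : E) :
      LeavittRel K Γ (gen K (vertex (Γ.s f)) * gen K (edge f)) (gen K (edge f))
  | edge_range (f : E) :
      LeavittRel K Γ (gen K (edge f) * gen K (vertex (Γ.r f))) (gen K (edge f))
  | range_ghost (f : E) :
      LeavittRel K Γ (gen K (vertex (Γ.r f)) * gen K (ghost f)) (gen K (ghost f))
  | ghost_source (f : E) :
      LeavittRel K Γ (gen K (ghost f) * gen K (vertex (Γ.s f))) (gen K (ghost f))
  | ghost_edge (f : E) :
      LeavittRel K Γ (gen K (ghost f) * gen K (edge f)) (gen K (vertex (Γ.r f)))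
  | ghost_edge_ne (f f' : E) : f ≠ f' →
      LeavittRel K Γ (gen K (ghost f) * gen K (edge f')) 0
  | sum_edges (x : V) (F : Finset E) : F.Nonempty → (∀ f : E, f ∈ F ↔ Γ.s f = x) →
      LeavittRel K Γ (gen K (vertex x)) (∑ f ∈ F, gen K (edge f) * gen K (ghost f))

/-- The scalar multiples of the relations. The ring congruence that they generate is compatible
with scalars, and so it is the congruence of `K`-algebras generated by the relations. -/
def LeavittRelSMul (K : Type w) [Field K] (Γ : DirectedGraph V E) (a b : FreeAlg K V E) : Prop :=
  ∃ (k : K) (a' b' : FreeAlg K V E), LeavittRel K Γ a' b' ∧ a = k • a' ∧ b = k • b'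

/-- The congruence on the free algebra generated by the defining relations. -/
noncomputable def leavittCon (K : Type w) [Field K] (Γ : DirectedGraph V E) : RingCon (FreeAlg K V E) :=
  ringConGen (LeavittRelSMul K Γ)

theorem leavittCon_smul (K : Type w) [Field K] (Γ : DirectedGraph V E) (k : K)
    {a b : FreeAlg K V E} (h : leavittCon K Γ a b) : leavittCon K Γ (k • a) (k • b) := by
  have h' : RingConGen.Rel (LeavittRelSMul K Γ) a b := h
  show RingConGen.Rel (LeavittRelSMul K Γ) (k • a) (k • b)
  clear h
  induction h' with
  | of x y hxy =>
    obtain ⟨l, a', b', hab, rfl, rfl⟩ := hxy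
    exact .of _ _ ⟨k * l, a', b', hab, by rw [mul_smul], by rw [mul_smul]⟩
  | refl x => exact .refl _
  | symm h ih => exact .symm ih
  | trans h₁ h₂ ih₁ ih₂ => exact .trans ih₁ ih₂
  | add h₁ h₂ ih₁ ih₂ => rw [smul_add, smul_add]; exact .add ih₁ ih₂
  | mul h₁ h₂ ih₁ ih₂ =>
    rw [← smul_mul_assoc, ← smul_mul_assoc]; exact .mul ih₁ h₂

/-- The Leavitt path algebra of the graph with coefficients in `K`. It is not assumed to have a
unit. -/
def LeavittPathAlgebra (K : Type w) [Field K] (Γ : DirectedGraph V E) : Type (max u v w) :=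
  (leavittCon K Γ).Quotient

namespace LeavittPathAlgebra

variable (K : Type w) [Field K] (Γ : DirectedGraph V E)

noncomputable instance : NonUnitalRing (LeavittPathAlgebra K Γ) :=
  inferInstanceAs (NonUnitalRing (leavittCon K Γ).Quotient)

/-- The quotient map from the free algebra. -/
noncomputable def mk (a : FreeAlg K V E) : LeavittPathAlgebra K Γ := (a : (leavittCon K Γ).Quotient)

theorem mk_surjective : Function.Surjective (mk K Γ) := Quotient.mk''_surjective

theorem mk_add (a b : FreeAlg K V E) : mk K Γ (a + b) = mk K Γ a + mk K Γ b := rfl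

theorem mk_mul (a b : FreeAlg K V E) : mk K Γ (a * b) = mk K Γ a * mk K Γ b := rfl

theorem mk_zero : mk K Γ 0 = 0 := rfl

theorem mk_eq {a b : FreeAlg K V E} : mk K Γ a = mk K Γ b ↔ leavittCon K Γ a b :=
  RingCon.eq (leavittCon K Γ)

noncomputable instance : SMul K (LeavittPathAlgebra K Γ) :=
  ⟨fun k => Quotient.map' (k • ·) fun _ _ h => leavittCon_smul K Γ k h⟩

theorem mk_smul (k : K) (a : FreeAlg K V E) : mk K Γ (k • a) = k • mk K Γ a := rfl

noncomputable instance : Module K (LeavittPathAlgebra K Γ) :=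
  Function.Surjective.module K
    ({ toFun := mk K Γ, map_zero' := rfl, map_add' := fun _ _ => rfl } :
      FreeAlg K V E →+ LeavittPathAlgebra K Γ)
    (mk_surjective K Γ) (fun _ _ => rfl)

/-- The generator `v`, for a vertex `v`. -/
noncomputable def vertex (x : V) : LeavittPathAlgebra K Γ := mk K Γ (gen K (Gen.vertex x))

/-- The generator `f`, for an edge `f`. -/
noncomputable def edge (f : E) : LeavittPathAlgebra K Γ := mk K Γ (gen K (Gen.edge f))

/-- The generator `f*`, for an edge `f`. -/
noncomputable def ghost (f : E) : LeavittPathAlgebra K Γ := mk K Γ (gen K (Gen.ghost f))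

end LeavittPathAlgebra

/-! ### Paths and the partial action of the free group on the set `X` -/

/-- The list of edges `a` is a path from the vertex `x` to the vertex `y`; the empty list is the
path of length zero at `x`. -/
def IsPath (Γ : DirectedGraph V E) : V → List E → V → Prop
  | x, [], y => x = y
  | x, f :: a, y => Γ.s f = x ∧ IsPath Γ (Γ.r f) a y

/-- The set `X`: the finite paths that end in a sink (a sink itself is such a path, of length zero),
and the infinite paths. -/
inductive BoundaryPath (Γ : DirectedGraph V E) : Type (max u v)
  | finite (x : V) (a : List E) (h : ∃ y : V, Γ.IsSink y ∧ Γ.IsPath x a y) : BoundaryPath Γ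
  | infinite (p : ℕ → E) (h : ∀ i : ℕ, Γ.r (p i) = Γ.s (p (i + 1))) : BoundaryPath Γ

namespace BoundaryPath

variable {Γ : DirectedGraph V E}

/-- The source of a path in `X`. -/
def source : BoundaryPath Γ → V
  | finite x _ _ => x
  | infinite p _ => Γ.s (p 0)

/-- The path `f ξ`, for an edge `f` and a path `ξ` with `s(ξ) = r(f)`. -/
def cons (f : E) : (ξ : BoundaryPath Γ) → Γ.r f = ξ.source → BoundaryPath Γ
  | finite _ a h, hf =>
    finite (Γ.s f) (f :: a) (h.imp fun _ hy => ⟨hy.1, rfl, by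
      have hf' : Γ.r f = _ := hf
      rw [hf']; exact hy.2⟩)
  | infinite p h, hf =>
    infinite (fun n => Nat.casesOn n f p) (fun i => by
      cases i with
      | zero => exact hf
      | succ i => exact h i)

/-- `η = f ξ`. -/
def IsCons (f : E) (ξ η : BoundaryPath Γ) : Prop := ∃ h : Γ.r f = ξ.source, η = cons f ξ h

/-- `η = a ξ`, for a list of edges `a`; this entails that `a` is a path with `r(a) = s(ξ)`. -/
def IsConcat : List E → BoundaryPath Γ → BoundaryPath Γ → Prop
  | [], ξ, η => η = ξ
  | f :: a, ξ, η => ∃ ζ, IsConcat a ξ ζ ∧ IsCons f ζ η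

/-- The path `ξ` begins with the path `a`. -/
def BeginsWith (ξ : BoundaryPath Γ) (a : List E) : Prop := ∃ ζ, IsConcat a ζ ξ

end BoundaryPath

/-- The word `a b⁻¹` in the letters `f`, `f⁻¹`. -/
def pathWord (a b : List E) : List (E × Bool) :=
  a.map (fun f => (f, true)) ++ FreeGroup.invRev (b.map fun f => (f, true))

/-- The set `X_g`, for an element `g` of the free group on the edges. -/
def domain (Γ : DirectedGraph V E) (g : FreeGroup E) : Set (BoundaryPath Γ) :=
  {ξ | g = 1 ∨
    (∃ x b y, b ≠ [] ∧ Γ.IsPath x b y ∧ g = FreeGroup.mk (pathWord [] b) ∧ ξ.source = y) ∨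
    (∃ x a y, a ≠ [] ∧ Γ.IsPath x a y ∧ g = FreeGroup.mk (pathWord a []) ∧ ξ.BeginsWith a) ∨
    (∃ x a x' b y, a ≠ [] ∧ b ≠ [] ∧ Γ.IsPath x a y ∧ Γ.IsPath x' b y ∧
      FreeGroup.IsReduced (pathWord a b) ∧ g = FreeGroup.mk (pathWord a b) ∧ ξ.BeginsWith a)}

/-- `θ_g(ξ) = η`, as a relation: `ξ = b ζ` and `η = a ζ`, where `g = a b⁻¹` is in reduced form.
Here `a` and `b` may have length zero, which covers `g = 1`, `g = a` and `g = b⁻¹`. -/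
def Theta (Γ : DirectedGraph V E) (g : FreeGroup E) (ξ η : BoundaryPath Γ) : Prop :=
  ∃ (a b : List E) (ζ : BoundaryPath Γ), FreeGroup.IsReduced (pathWord a b) ∧
    g = FreeGroup.mk (pathWord a b) ∧ BoundaryPath.IsConcat b ζ ξ ∧ BoundaryPath.IsConcat a ζ η

section PathLemmas

variable {Γ : DirectedGraph V E}

open BoundaryPath

theorem IsPath.unique {x y y' : V} {a : List E} (h : Γ.IsPath x a y) (h' : Γ.IsPath x a y') :
    y = y' := by
  induction a generalizing x with
  | nil => exact Eq.trans (Eq.symm h) h'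
  | cons f a ih => exact ih h.2 h'.2

theorem IsPath.eq_of_ne_nil {x x' y y' : V} {a : List E} (ha : a ≠ []) (h : Γ.IsPath x a y)
    (h' : Γ.IsPath x' a y') : x = x' ∧ y = y' := by
  cases a with
  | nil => exact absurd rfl ha
  | cons f a => exact ⟨h.1.symm.trans h'.1, h.2.unique h'.2⟩

theorem BoundaryPath.source_cons (f : E) (ξ : BoundaryPath Γ) (h : Γ.r f = ξ.source) :
    (cons f ξ h).source = Γ.s f := by
  cases ξ <;> rfl

theorem BoundaryPath.IsCons.inj {f f' : E} {ζ ζ' η : BoundaryPath Γ} (h : IsCons f ζ η)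
    (h' : IsCons f' ζ' η) : f = f' ∧ ζ = ζ' := by
  obtain ⟨h, rfl⟩ := h
  obtain ⟨h', e⟩ := h'
  cases ζ with
  | finite x a hx =>
    cases ζ' with
    | finite x' a' hx' =>
      simp only [cons, finite.injEq, List.cons.injEq] at e
      obtain ⟨-, rfl, rfl⟩ := e
      have : x = x' := Eq.trans (Eq.symm h) h'
      subst this
      exact ⟨rfl, rfl⟩
    | infinite p' hp' => simp [cons] at e
  | infinite p hp =>
    cases ζ' with
    | finite x' a' hx' => simp [cons] at e
    | infinite p' hp' =>
      simp only [cons, infinite.injEq] at e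
      have h0 : f = f' := congrFun e 0
      have h1 : p = p' := funext fun n => congrFun e (n + 1)
      subst h0 h1
      exact ⟨rfl, rfl⟩

theorem BoundaryPath.IsCons.unique {f : E} {ζ η η' : BoundaryPath Γ} (h : IsCons f ζ η)
    (h' : IsCons f ζ η') : η = η' := by
  obtain ⟨h, rfl⟩ := h
  obtain ⟨h', rfl⟩ := h'
  rfl

theorem BoundaryPath.IsConcat.isPath {a : List E} {ζ η : BoundaryPath Γ} (h : IsConcat a ζ η) :
    Γ.IsPath η.source a ζ.source := by
  induction a generalizing η with
  | nil => cases h; exact rfl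
  | cons f a ih =>
    obtain ⟨μ, h₁, h₂, rfl⟩ := h
    refine ⟨(source_cons f μ h₂).symm, ?_⟩
    rw [h₂]
    exact ih h₁

theorem BoundaryPath.exists_isConcat {a : List E} {x : V} {ζ : BoundaryPath Γ}
    (h : Γ.IsPath x a ζ.source) : ∃ η, IsConcat a ζ η ∧ η.source = x := by
  induction a generalizing x with
  | nil => exact ⟨ζ, rfl, Eq.symm h⟩
  | cons f a ih =>
    obtain ⟨μ, h₁, h₂⟩ := ih h.2
    exact ⟨cons f μ h₂.symm, ⟨μ, h₁, h₂.symm, rfl⟩, (source_cons _ _ _).trans h.1⟩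

theorem BoundaryPath.isConcat_append {a c : List E} {ζ ξ : BoundaryPath Γ} :
    IsConcat (a ++ c) ζ ξ ↔ ∃ ζ', IsConcat c ζ ζ' ∧ IsConcat a ζ' ξ := by
  induction a generalizing ξ with
  | nil => simp [IsConcat]
  | cons f a ih =>
    simp only [List.cons_append, IsConcat, ih]
    constructor
    · rintro ⟨μ, ⟨ν, h₁, h₂⟩, h₃⟩; exact ⟨ν, h₁, μ, h₂, h₃⟩
    · rintro ⟨ν, h₁, μ, h₂, h₃⟩; exact ⟨μ, ⟨ν, h₁, h₂⟩, h₃⟩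

theorem BoundaryPath.BeginsWith.prefix {a b : List E} {ξ : BoundaryPath Γ} (h : ξ.BeginsWith b)
    (hab : a <+: b) : ξ.BeginsWith a := by
  obtain ⟨c, rfl⟩ := hab
  obtain ⟨ζ, h⟩ := h
  obtain ⟨ζ', -, h'⟩ := isConcat_append.1 h
  exact ⟨ζ', h'⟩

theorem BoundaryPath.BeginsWith.comparable {a b : List E} {ξ : BoundaryPath Γ}
    (ha : ξ.BeginsWith a) (hb : ξ.BeginsWith b) : a <+: b ∨ b <+: a := by
  induction a generalizing b ξ with
  | nil => exact Or.inl List.nil_prefix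
  | cons f a ih =>
    cases b with
    | nil => exact Or.inr List.nil_prefix
    | cons f' b =>
      obtain ⟨ζ, μ, h₁, h₂⟩ := ha
      obtain ⟨ζ', μ', h₁', h₂'⟩ := hb
      obtain ⟨rfl, rfl⟩ := h₂.inj h₂'
      simpa using ih ⟨ζ, h₁⟩ ⟨ζ', h₁'⟩

/-- The action of a word in the letters `f`, `f⁻¹` on `X`, letter by letter, as a relation. -/
def ActRel : List (E × Bool) → BoundaryPath Γ → BoundaryPath Γ → Prop
  | [], ξ, η => η = ξ
  | (f, true) :: w, ξ, η => ∃ ζ, ActRel w ξ ζ ∧ IsCons f ζ η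
  | (f, false) :: w, ξ, η => ∃ ζ, ActRel w ξ ζ ∧ IsCons f η ζ

theorem actRel_append {w w' : List (E × Bool)} {ξ η : BoundaryPath Γ} :
    ActRel (w ++ w') ξ η ↔ ∃ ζ, ActRel w' ξ ζ ∧ ActRel w ζ η := by
  induction w generalizing η with
  | nil => simp [ActRel]
  | cons l w ih =>
    obtain ⟨f, _ | _⟩ := l <;>
    · simp only [List.cons_append, ActRel, ih]
      constructor
      · rintro ⟨μ, ⟨ν, h₁, h₂⟩, h₃⟩; exact ⟨ν, h₁, μ, h₂, h₃⟩
      · rintro ⟨ν, h₁, μ, h₂, h₃⟩; exact ⟨μ, ⟨ν, h₁, h₂⟩, h₃⟩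

theorem ActRel.unique {w : List (E × Bool)} {ξ η η' : BoundaryPath Γ} (h : ActRel w ξ η)
    (h' : ActRel w ξ η') : η = η' := by
  induction w generalizing η η' with
  | nil => exact Eq.trans h (Eq.symm h')
  | cons l w ih =>
    obtain ⟨f, _ | _⟩ := l
    · obtain ⟨ζ, h₁, h₂⟩ := h
      obtain ⟨ζ', h₁', h₂'⟩ := h'
      obtain rfl := ih h₁ h₁'
      exact (h₂.inj h₂').2
    · obtain ⟨ζ, h₁, h₂⟩ := h
      obtain ⟨ζ', h₁', h₂'⟩ := h'
      obtain rfl := ih h₁ h₁'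
      exact h₂.unique h₂'

theorem ActRel.red {w w' : List (E × Bool)} (hw : FreeGroup.Red w w') {ξ η : BoundaryPath Γ}
    (h : ActRel w ξ η) : ActRel w' ξ η := by
  induction hw with
  | refl => exact h
  | tail _ hs ih =>
    cases hs with
    | @not L₁ L₂ f b =>
      obtain ⟨ζ, h₁, h₂⟩ := actRel_append.1 ih
      refine actRel_append.2 ⟨ζ, ?_, h₂⟩
      cases b with
      | false =>
        obtain ⟨μ, ⟨ν, h₃, h₄⟩, h₅⟩ := h₁
        obtain rfl := (h₄.inj h₅).2
        exact h₃
      | true =>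
        obtain ⟨μ, ⟨ν, h₃, h₄⟩, h₅⟩ := h₁
        obtain rfl := h₄.unique h₅
        exact h₃

theorem ActRel.inv {w : List (E × Bool)} {ξ η : BoundaryPath Γ} (h : ActRel w ξ η) :
    ActRel (FreeGroup.invRev w) η ξ := by
  induction w generalizing η with
  | nil => exact Eq.symm h
  | cons l w ih =>
    rw [FreeGroup.invRev_cons]
    obtain ⟨f, _ | _⟩ := l <;>
    · obtain ⟨ζ, h₁, h₂⟩ := h
      exact actRel_append.2 ⟨ζ, ⟨_, rfl, h₂⟩, ih h₁⟩

theorem actRel_map_true {a : List E} {ζ η : BoundaryPath Γ} :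
    ActRel (a.map fun f => (f, true)) ζ η ↔ IsConcat a ζ η := by
  induction a generalizing η with
  | nil => exact Iff.rfl
  | cons f a ih => simp only [List.map_cons, ActRel, IsConcat, ih]

theorem actRel_pathWord {a b : List E} {ξ η : BoundaryPath Γ} :
    ActRel (pathWord a b) ξ η ↔ ∃ ζ, IsConcat b ζ ξ ∧ IsConcat a ζ η := by
  rw [pathWord, actRel_append]
  refine exists_congr fun ζ => ?_
  rw [actRel_map_true, ← actRel_map_true (a := b)]
  exact and_congr_left fun _ => ⟨fun h => by simpa using h.inv, fun h => h.inv⟩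

theorem pathWord_cons (f : E) (a b : List E) :
    pathWord (f :: a) b = (f, true) :: pathWord a b := rfl

theorem pathWord_nil_append_singleton (b : List E) (f : E) :
    pathWord [] (b ++ [f]) = (f, false) :: pathWord [] b := by
  simp [pathWord, FreeGroup.invRev]

theorem ActRel.exists_pathWord {w : List (E × Bool)} (hw : FreeGroup.IsReduced w)
    {ξ η : BoundaryPath Γ} (h : ActRel w ξ η) : ∃ a b : List E, w = pathWord a b := by
  induction w generalizing η with
  | nil => exact ⟨[], [], rfl⟩
  | cons l w ih =>
    have hw' : FreeGroup.IsReduced w := hw.infix ⟨[l], [], by simp⟩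
    obtain ⟨f, _ | _⟩ := l
    · obtain ⟨ζ, h₁, h₂⟩ := h
      obtain ⟨a, b, rfl⟩ := ih hw' h₁
      cases a with
      | nil => exact ⟨[], b ++ [f], (pathWord_nil_append_singleton b f).symm⟩
      | cons f' a =>
        exfalso
        obtain ⟨_, _, _, _, h₃⟩ := actRel_pathWord.1 h₁
        obtain ⟨rfl, -⟩ := h₂.inj h₃
        rw [pathWord_cons, FreeGroup.isReduced_cons_cons] at hw
        exact absurd (hw.1 rfl) (by simp)
    · obtain ⟨ζ, h₁, h₂⟩ := h
      obtain ⟨a, b, rfl⟩ := ih hw' h₁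
      exact ⟨f :: a, b, rfl⟩

theorem pathWord_inj {a b a' b' : List E} (h : pathWord a b = pathWord a' b') :
    a = a' ∧ b = b' := by
  induction a generalizing a' with
  | nil =>
    cases a' with
    | nil =>
      refine ⟨rfl, ?_⟩
      have := FreeGroup.invRev_injective (by simpa [pathWord] using h)
      exact List.map_injective_iff.2 (fun _ _ h => (Prod.ext_iff.1 h).1) this
    | cons f a' =>
      exfalso
      have : (f, true) ∈ pathWord [] b := h ▸ (by simp [pathWord])
      simp [pathWord, FreeGroup.invRev] at this
  | cons f a ih =>
    cases a' with
    | nil =>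
      exfalso
      have : (f, true) ∈ pathWord [] b' := h ▸ (by simp [pathWord])
      simp [pathWord, FreeGroup.invRev] at this
    | cons f' a' =>
      simp only [pathWord_cons, List.cons.injEq, Prod.mk.injEq] at h
      obtain ⟨h₁, h₂⟩ := ih h.2
      exact ⟨by rw [h.1.1, h₁], h₂⟩

open Classical in
theorem theta_iff_actRel {g : FreeGroup E} {ξ η : BoundaryPath Γ} :
    Γ.Theta g ξ η ↔ ActRel g.toWord ξ η := by
  constructor
  · rintro ⟨a, b, ζ, hr, rfl, hb, ha⟩
    rw [FreeGroup.toWord_mk, hr.reduce_eq]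
    exact actRel_pathWord.2 ⟨ζ, hb, ha⟩
  · intro h
    obtain ⟨a, b, hab⟩ := h.exists_pathWord FreeGroup.isReduced_toWord
    rw [hab] at h
    obtain ⟨ζ, hb, ha⟩ := actRel_pathWord.1 h
    exact ⟨a, b, ζ, hab ▸ FreeGroup.isReduced_toWord, by rw [← hab, FreeGroup.mk_toWord], hb, ha⟩

open Classical in
theorem Theta.unique {g : FreeGroup E} {ξ η η' : BoundaryPath Γ} (h : Γ.Theta g ξ η)
    (h' : Γ.Theta g ξ η') : η = η' :=
  (theta_iff_actRel.1 h).unique (theta_iff_actRel.1 h')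

open Classical in
theorem Theta.inv {g : FreeGroup E} {ξ η : BoundaryPath Γ} (h : Γ.Theta g ξ η) :
    Γ.Theta g⁻¹ η ξ := by
  rw [theta_iff_actRel, FreeGroup.toWord_inv]
  exact (theta_iff_actRel.1 h).inv

open Classical in
theorem Theta.trans {g h : FreeGroup E} {ξ η ζ : BoundaryPath Γ} (hh : Γ.Theta h ξ η)
    (hg : Γ.Theta g η ζ) : Γ.Theta (g * h) ξ ζ := by
  rw [theta_iff_actRel, FreeGroup.toWord_mul]
  exact ActRel.red FreeGroup.reduce.red
    (actRel_append.2 ⟨η, theta_iff_actRel.1 hh, theta_iff_actRel.1 hg⟩)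

open Classical in
theorem theta_one {ξ η : BoundaryPath Γ} : Γ.Theta 1 ξ η ↔ η = ξ := by
  rw [theta_iff_actRel, FreeGroup.toWord_one]
  exact Iff.rfl

theorem isReduced_map {a : List E} {b : Bool} :
    FreeGroup.IsReduced (a.map fun f => (f, b)) := by
  induction a with
  | nil => exact FreeGroup.IsReduced.nil
  | cons f a ih =>
    cases a with
    | nil => exact FreeGroup.IsReduced.singleton
    | cons f' a => exact FreeGroup.isReduced_cons_cons.2 ⟨fun _ => rfl, ih⟩

theorem isReduced_pathWord_nil_right (a : List E) : FreeGroup.IsReduced (pathWord a []) := by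
  simpa [pathWord] using isReduced_map (a := a) (b := true)

theorem isReduced_pathWord_nil_left (b : List E) : FreeGroup.IsReduced (pathWord [] b) := by
  have := isReduced_map (a := b.reverse) (b := false)
  simpa [pathWord, FreeGroup.invRev, Function.comp_def] using this

/-- `X_g` is the image of `θ_g`. -/
theorem mem_domain_iff {g : FreeGroup E} {η : BoundaryPath Γ} :
    η ∈ Γ.domain g ↔ ∃ ξ, Γ.Theta g ξ η := by
  constructor
  · rintro (rfl | ⟨x, b, y, -, hp, rfl, rfl⟩ | ⟨x, a, y, -, hp, rfl, ζ, hζ⟩ |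
      ⟨x, a, x', b, y, ha, -, hp, hp', hr, rfl, ζ, hζ⟩)
    · exact ⟨η, theta_one.2 rfl⟩
    · obtain ⟨ξ, hξ, -⟩ := exists_isConcat hp
      exact ⟨ξ, [], b, η, isReduced_pathWord_nil_left b, rfl, hξ, rfl⟩
    · exact ⟨ζ, a, [], ζ, isReduced_pathWord_nil_right a, rfl, rfl, hζ⟩
    · obtain rfl := (hp.eq_of_ne_nil ha hζ.isPath).2
      obtain ⟨ξ, hξ, -⟩ := exists_isConcat hp'
      exact ⟨ξ, a, b, ζ, hr, rfl, hξ, hζ⟩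
  · rintro ⟨ξ, a, b, ζ, hr, rfl, hb, ha⟩
    rcases eq_or_ne a [] with rfl | ha'
    · rcases eq_or_ne b [] with rfl | hb'
      · exact Or.inl rfl
      · obtain rfl : η = ζ := ha
        exact Or.inr (Or.inl ⟨_, b, _, hb', hb.isPath, rfl, rfl⟩)
    · rcases eq_or_ne b [] with rfl | hb'
      · exact Or.inr (Or.inr (Or.inl ⟨_, a, _, ha', ha.isPath, rfl, ζ, ha⟩))
      · exact Or.inr (Or.inr (Or.inr
          ⟨_, a, _, b, _, ha', hb', ha.isPath, hb.isPath, hr, rfl, ζ, ha⟩))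

theorem mem_domain_inv_iff {g : FreeGroup E} {ξ : BoundaryPath Γ} :
    ξ ∈ Γ.domain g⁻¹ ↔ ∃ η, Γ.Theta g ξ η := by
  rw [mem_domain_iff]
  exact ⟨fun ⟨η, h⟩ => ⟨η, by simpa using h.inv⟩, fun ⟨η, h⟩ => ⟨η, h.inv⟩⟩

theorem Theta.mem_domain_mul_iff {g h : FreeGroup E} {ξ η : BoundaryPath Γ} (hg : Γ.Theta g ξ η) :
    η ∈ Γ.domain (g * h) ↔ ξ ∈ Γ.domain h := by
  rw [mem_domain_iff, mem_domain_iff]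
  exact ⟨fun ⟨μ, hμ⟩ => ⟨μ, by simpa using hμ.trans hg.inv⟩, fun ⟨μ, hμ⟩ => ⟨μ, hμ.trans hg⟩⟩

/-- The paths in `X` that start at the vertex `x` and begin with `a`. -/
def cylinder (Γ : DirectedGraph V E) (x : V) (a : List E) : Set (BoundaryPath Γ) :=
  {ξ | ξ.source = x ∧ ξ.BeginsWith a}

open Classical in
theorem domain_eq_cylinder {g : FreeGroup E} (hg : g ≠ 1) :
    Γ.domain g = ∅ ∨ ∃ x a, Γ.domain g = Γ.cylinder x a := by
  rcases (Γ.domain g).eq_empty_or_nonempty with h | ⟨η₀, h⟩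
  · exact Or.inl h
  · right
    obtain ⟨ξ₀, a, b, ζ₀, hr, rfl, hb₀, ha₀⟩ := mem_domain_iff.1 h
    refine ⟨η₀.source, a, Set.ext fun η => ?_⟩
    rw [mem_domain_iff]
    constructor
    · rintro ⟨ξ, a', b', ζ, hr', he, hb, ha⟩
      have he' := congrArg FreeGroup.toWord he
      rw [FreeGroup.toWord_mk, FreeGroup.toWord_mk, hr.reduce_eq, hr'.reduce_eq] at he'
      obtain ⟨rfl, rfl⟩ := pathWord_inj he'
      refine ⟨?_, ζ, ha⟩
      rcases eq_or_ne a [] with rfl | hne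
      · rcases eq_or_ne b [] with rfl | hne
        · exact absurd rfl hg
        · obtain rfl : η = ζ := ha
          obtain rfl : η₀ = ζ₀ := ha₀
          exact (hb.isPath.eq_of_ne_nil hne hb₀.isPath).2
      · exact (ha.isPath.eq_of_ne_nil hne ha₀.isPath).1
    · rintro ⟨hs, ζ, ha⟩
      have hz : ζ.source = ζ₀.source := (hs ▸ ha.isPath).unique ha₀.isPath
      obtain ⟨ξ, hξ, -⟩ := exists_isConcat (ζ := ζ) (hz ▸ hb₀.isPath)
      exact ⟨ξ, a, b, ζ, hr, rfl, hξ, ha⟩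

theorem cylinder_inter (x y : V) (a b : List E) :
    Γ.cylinder x a ∩ Γ.cylinder y b = ∅ ∨ Γ.cylinder x a ∩ Γ.cylinder y b = Γ.cylinder x a ∨
      Γ.cylinder x a ∩ Γ.cylinder y b = Γ.cylinder y b := by
  rcases (Γ.cylinder x a ∩ Γ.cylinder y b).eq_empty_or_nonempty with h | ⟨ξ, ⟨rfl, ha⟩, ⟨rfl, hb⟩⟩
  · exact Or.inl h
  · right
    rcases ha.comparable hb with h | h
    · exact Or.inr (Set.inter_eq_right.2 fun η hη => ⟨hη.1, hη.2.prefix h⟩)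
    · exact Or.inl (Set.inter_eq_left.2 fun η hη => ⟨hη.1, hη.2.prefix h⟩)

end PathLemmas

/-! ### The algebra `D(X)` and the partial action of the free group on it -/

section DX

variable (K : Type w) [Field K] (Γ : DirectedGraph V E)

/-- The set `X_v` of the paths in `X` with source `v`. -/
def vertexSet (x : V) : Set (BoundaryPath Γ) := {ξ | ξ.source = x}

/-- The characteristic function of a subset of `X`, with values in `K`. -/
noncomputable def char (A : Set (BoundaryPath Γ)) : BoundaryPath Γ → K := A.indicator 1

/-- The functions `1_g`, for `g ≠ 1`, and `1_v`. -/
def spanningSet : Set (BoundaryPath Γ → K) :=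
  {f | ∃ g : FreeGroup E, g ≠ 1 ∧ f = char K Γ (Γ.domain g)} ∪
    {f | ∃ x : V, f = char K Γ (Γ.vertexSet x)}

variable {K Γ}

theorem char_of_mem {A : Set (BoundaryPath Γ)} {ξ : BoundaryPath Γ} (h : ξ ∈ A) :
    char K Γ A ξ = 1 := Set.indicator_of_mem h _

theorem char_of_notMem {A : Set (BoundaryPath Γ)} {ξ : BoundaryPath Γ} (h : ξ ∉ A) :
    char K Γ A ξ = 0 := Set.indicator_of_notMem h _

theorem char_mul_char (A B : Set (BoundaryPath Γ)) :
    char K Γ A * char K Γ B = char K Γ (A ∩ B) := by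
  funext ξ
  by_cases hA : ξ ∈ A <;> by_cases hB : ξ ∈ B <;>
    simp [char, hA, hB]

theorem char_empty : char K Γ ∅ = 0 := Set.indicator_empty _

theorem spanningSet_cylinder {f : BoundaryPath Γ → K} (hf : f ∈ spanningSet K Γ) :
    f = 0 ∨ ∃ x a, f = char K Γ (Γ.cylinder x a) := by
  rcases hf with ⟨g, hg, rfl⟩ | ⟨x, rfl⟩
  · rcases domain_eq_cylinder (Γ := Γ) hg with h | ⟨x, a, h⟩
    · exact Or.inl (by rw [h, char_empty])
    · exact Or.inr ⟨x, a, by rw [h]⟩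
  · refine Or.inr ⟨x, [], congrArg _ (Set.ext fun ξ => ?_)⟩
    exact ⟨fun h => ⟨h, ξ, rfl⟩, fun h => h.1⟩

theorem mul_mem_span {f f' : BoundaryPath Γ → K} (hf : f ∈ spanningSet K Γ)
    (hf' : f' ∈ spanningSet K Γ) : f * f' ∈ Submodule.span K (spanningSet K Γ) := by
  rcases spanningSet_cylinder hf with h | ⟨x, a, h⟩
  · rw [h, zero_mul]; exact zero_mem _
  rcases spanningSet_cylinder hf' with h' | ⟨x', a', h'⟩
  · rw [h', mul_zero]; exact zero_mem _
  have e : f * f' = char K Γ (Γ.cylinder x a ∩ Γ.cylinder x' a') := by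
    rw [h, h', char_mul_char]
  rcases cylinder_inter (Γ := Γ) x x' a a' with hc | hc | hc
  · rw [e, hc, char_empty]; exact zero_mem _
  · rw [e, hc, ← h]; exact Submodule.subset_span hf
  · rw [e, hc, ← h']; exact Submodule.subset_span hf'

variable (K Γ)

/-- The algebra `D(X)`: the linear span of the functions `1_g`, `g ≠ 1`, and `1_v`, inside the
algebra of all functions from `X` to `K`. -/
def DX : NonUnitalSubalgebra K (BoundaryPath Γ → K) :=
  { Submodule.span K (spanningSet K Γ) with
    mul_mem' := fun {a b} ha hb => by
      have h : Submodule.span K (spanningSet K Γ) * Submodule.span K (spanningSet K Γ) ≤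
          Submodule.span K (spanningSet K Γ) := by
        rw [Submodule.span_mul_span, Submodule.span_le]
        rintro _ ⟨f, hf, f', hf', rfl⟩
        exact mul_mem_span hf hf'
      exact h (Submodule.mul_mem_mul ha hb) }

theorem char_domain_mem {g : FreeGroup E} (hg : g ≠ 1) : char K Γ (Γ.domain g) ∈ DX K Γ :=
  Submodule.subset_span (Or.inl ⟨g, hg, rfl⟩)

theorem char_vertexSet_mem (x : V) : char K Γ (Γ.vertexSet x) ∈ DX K Γ :=
  Submodule.subset_span (Or.inr ⟨x, rfl⟩)

/-- The ideal `D_g = 1_g D(X)` of `D(X)`. (For `g = 1` this is `D(X)`.) -/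
noncomputable def idealD (g : FreeGroup E) : Submodule K (DX K Γ) where
  carrier := {f | ∃ h : DX K Γ, (f : BoundaryPath Γ → K) = char K Γ (Γ.domain g) * h}
  zero_mem' := ⟨0, by simp⟩
  add_mem' := by
    rintro _ _ ⟨h, hh⟩ ⟨h', hh'⟩
    exact ⟨h + h', by simp [hh, hh', mul_add]⟩
  smul_mem' := by
    rintro k _ ⟨h, hh⟩
    exact ⟨k • h, by simp [hh]⟩

open Classical in
/-- The map `α_g` on functions: `α_g(f) = f ∘ θ_{g⁻¹}` on `X_g`, and `0` elsewhere. -/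
noncomputable def transport (g : FreeGroup E) : (BoundaryPath Γ → K) →ₗ[K] (BoundaryPath Γ → K) where
  toFun f η := if h : ∃ ξ, Γ.Theta g⁻¹ η ξ then f h.choose else 0
  map_add' f f' := by
    funext η
    by_cases h : ∃ ξ, Γ.Theta g⁻¹ η ξ <;> simp [h]
  map_smul' k f := by
    funext η
    by_cases h : ∃ ξ, Γ.Theta g⁻¹ η ξ <;> simp [h]

variable {K Γ}

theorem transport_apply {g : FreeGroup E} {ξ η : BoundaryPath Γ} (h : Γ.Theta g ξ η)
    (f : BoundaryPath Γ → K) : transport K Γ g f η = f ξ := by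
  have h' : ∃ ξ, Γ.Theta g⁻¹ η ξ := ⟨ξ, h.inv⟩
  have : h'.choose = ξ := h'.choose_spec.unique h.inv
  exact (dif_pos h').trans (congrArg f this)

theorem transport_of_notMem {g : FreeGroup E} {η : BoundaryPath Γ} (h : η ∉ Γ.domain g)
    (f : BoundaryPath Γ → K) : transport K Γ g f η = 0 := by
  refine dif_neg fun ⟨ξ, hξ⟩ => h (mem_domain_iff.2 ⟨ξ, ?_⟩)
  simpa using hξ.inv

theorem mem_idealD_iff {g : FreeGroup E} {f : DX K Γ} :
    f ∈ idealD K Γ g ↔ ∀ η, η ∉ Γ.domain g → (f : BoundaryPath Γ → K) η = 0 := by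
  constructor
  · rintro ⟨h, hh⟩ η hη
    rw [hh, Pi.mul_apply, char_of_notMem hη, zero_mul]
  · intro h
    refine ⟨f, funext fun η => ?_⟩
    by_cases hη : η ∈ Γ.domain g
    · rw [Pi.mul_apply, char_of_mem hη, one_mul]
    · rw [Pi.mul_apply, char_of_notMem hη, zero_mul, h η hη]

theorem transport_char_domain (g h : FreeGroup E) :
    transport K Γ g (char K Γ (Γ.domain g⁻¹) * char K Γ (Γ.domain h)) =
      char K Γ (Γ.domain g) * char K Γ (Γ.domain (g * h)) := by
  funext η
  by_cases hη : η ∈ Γ.domain g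
  · obtain ⟨ξ, hξ⟩ := mem_domain_iff.1 hη
    rw [transport_apply hξ, Pi.mul_apply, Pi.mul_apply, char_of_mem hη,
      char_of_mem (mem_domain_inv_iff.2 ⟨η, hξ⟩)]
    by_cases hh : ξ ∈ Γ.domain h
    · rw [char_of_mem hh, char_of_mem (hξ.mem_domain_mul_iff.2 hh)]
    · rw [char_of_notMem hh, char_of_notMem (mt hξ.mem_domain_mul_iff.1 hh)]
  · rw [transport_of_notMem hη, Pi.mul_apply, char_of_notMem hη, zero_mul]

theorem transport_char_self (g : FreeGroup E) :
    transport K Γ g (char K Γ (Γ.domain g⁻¹)) = char K Γ (Γ.domain g) := by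
  funext η
  by_cases hη : η ∈ Γ.domain g
  · obtain ⟨ξ, hξ⟩ := mem_domain_iff.1 hη
    rw [transport_apply hξ, char_of_mem hη, char_of_mem (mem_domain_inv_iff.2 ⟨η, hξ⟩)]
  · rw [transport_of_notMem hη, char_of_notMem hη]

theorem transport_one (f : BoundaryPath Γ → K) : transport K Γ 1 f = f :=
  funext fun _ => transport_apply (theta_one.2 rfl) f

theorem char_domain_one_mul (f : BoundaryPath Γ → K) : char K Γ (Γ.domain 1) * f = f := by
  funext η
  rw [Pi.mul_apply, char_of_mem (Or.inl rfl), one_mul]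

theorem transport_mem_DX (g : FreeGroup E) (f : DX K Γ) :
    transport K Γ g (char K Γ (Γ.domain g⁻¹) * f) ∈ DX K Γ := by
  obtain ⟨f, hf⟩ := f
  rcases eq_or_ne g 1 with rfl | hg
  · rw [transport_one, inv_one, char_domain_one_mul]; exact hf
  have hle : Submodule.span K (spanningSet K Γ) ≤ (DX K Γ).toSubmodule.comap
      ((transport K Γ g).comp (LinearMap.mulLeft K (char K Γ (Γ.domain g⁻¹)))) := by
    rw [Submodule.span_le]
    rintro _ (⟨h, hh, rfl⟩ | ⟨x, rfl⟩)
    · show transport K Γ g (char K Γ (Γ.domain g⁻¹) * char K Γ (Γ.domain h)) ∈ DX K Γ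
      rw [transport_char_domain]
      rcases eq_or_ne (g * h) 1 with h1 | h1
      · rw [h1, mul_comm, char_domain_one_mul]; exact char_domain_mem K Γ hg
      · exact mul_mem (char_domain_mem K Γ hg) (char_domain_mem K Γ h1)
    · show transport K Γ g (char K Γ (Γ.domain g⁻¹) * char K Γ (Γ.vertexSet x)) ∈ DX K Γ
      rw [char_mul_char]
      have key : Γ.domain g⁻¹ ∩ Γ.vertexSet x = ∅ ∨
          Γ.domain g⁻¹ ∩ Γ.vertexSet x = Γ.domain g⁻¹ := by
        rcases domain_eq_cylinder (Γ := Γ) (inv_ne_one.2 hg) with h | ⟨y, a, h⟩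
        · exact Or.inl (by rw [h, Set.empty_inter])
        · rw [h]
          rcases eq_or_ne y x with rfl | hne
          · exact Or.inr (Set.inter_eq_left.2 fun η hη => hη.1)
          · exact Or.inl (Set.eq_empty_of_forall_notMem
              fun η hη => hne (hη.1.1.symm.trans hη.2))
      rcases key with h | h
      · rw [h, char_empty, map_zero]; exact zero_mem _
      · rw [h, transport_char_self]; exact char_domain_mem K Γ hg
  exact hle hf

theorem transport_mem {g : FreeGroup E} {f : DX K Γ} (hf : f ∈ idealD K Γ g⁻¹) :
    transport K Γ g f ∈ DX K Γ := by
  obtain ⟨h, hh⟩ := hf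
  rw [hh]
  exact transport_mem_DX g h

theorem transport_transport {g : FreeGroup E} {f : DX K Γ} (hf : f ∈ idealD K Γ g⁻¹) :
    transport K Γ g⁻¹ (transport K Γ g f) = f := by
  funext ξ
  by_cases hξ : ξ ∈ Γ.domain g⁻¹
  · obtain ⟨η, hη⟩ := mem_domain_inv_iff.1 hξ
    rw [transport_apply hη.inv, transport_apply hη]
  · rw [transport_of_notMem hξ, mem_idealD_iff.1 hf ξ hξ]

variable (K Γ)

/-- The map `α_g : D_{g⁻¹} → D_g`. -/
noncomputable def alphaMap (g : FreeGroup E) : idealD K Γ g⁻¹ →ₗ[K] idealD K Γ g where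
  toFun f := ⟨⟨transport K Γ g f.1, transport_mem f.2⟩,
    mem_idealD_iff.2 fun _ hη => transport_of_notMem hη _⟩
  map_add' _ _ := Subtype.ext (Subtype.ext (map_add (transport K Γ g) _ _))
  map_smul' _ _ := Subtype.ext (Subtype.ext (map_smul (transport K Γ g) _ _))

/-- The isomorphism `α_g : D_{g⁻¹} → D_g`, `f ↦ f ∘ θ_{g⁻¹}`. -/
noncomputable def alphaEquiv (g : FreeGroup E) : idealD K Γ g⁻¹ ≃ₗ[K] idealD K Γ g :=
  LinearEquiv.ofBijective (alphaMap K Γ g)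
    ⟨fun f f' h => by
      have h' : transport K Γ g f.1 = transport K Γ g f'.1 :=
        congrArg (fun z : idealD K Γ g => (z : DX K Γ).1) h
      exact Subtype.ext (Subtype.ext (by
        rw [← transport_transport f.2, ← transport_transport f'.2, h'])),
    fun f => by
      have hf : (f : DX K Γ) ∈ idealD K Γ (g⁻¹)⁻¹ := by rw [inv_inv]; exact f.2
      refine ⟨alphaMap K Γ g⁻¹ ⟨f, hf⟩, Subtype.ext (Subtype.ext ?_)⟩
      have := transport_transport hf
      rw [inv_inv] at this
      exact this⟩

/-- The partial action `(D_g, α_g)` of the free group on the edges on the algebra `D(X)`. -/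
noncomputable def freeGroupAction : PartialAction K (FreeGroup E) (DX K Γ) where
  D := idealD K Γ
  mul_mem_left g r x hx := mem_idealD_iff.2 fun η hη => by
    show (r : BoundaryPath Γ → K) η * (x : BoundaryPath Γ → K) η = 0
    rw [mem_idealD_iff.1 hx η hη, mul_zero]
  mul_mem_right g r x hx := mem_idealD_iff.2 fun η hη => by
    show (x : BoundaryPath Γ → K) η * (r : BoundaryPath Γ → K) η = 0
    rw [mem_idealD_iff.1 hx η hη, zero_mul]
  α := alphaEquiv K Γ
  map_mul g x y := Subtype.ext <| funext fun η => by
    show transport K Γ g (x.1.1 * y.1.1) η = transport K Γ g x.1.1 η * transport K Γ g y.1.1 η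
    by_cases hη : η ∈ Γ.domain g
    · obtain ⟨ξ, hξ⟩ := mem_domain_iff.1 hη
      simp only [transport_apply hξ, Pi.mul_apply]
    · simp only [transport_of_notMem hη, mul_zero]
  D_one := eq_top_iff.2 fun f _ => mem_idealD_iff.2 fun η hη => absurd (Or.inl rfl) hη
  α_one x := Subtype.ext (transport_one _)
  image_inter g h := by
    ext y
    constructor
    · rintro ⟨x, hx, rfl⟩
      refine ⟨(alphaEquiv K Γ g x).2, mem_idealD_iff.2 fun η hη => ?_⟩
      show transport K Γ g x.1.1 η = 0
      by_cases hη' : η ∈ Γ.domain g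
      · obtain ⟨ξ, hξ⟩ := mem_domain_iff.1 hη'
        rw [transport_apply hξ]
        exact mem_idealD_iff.1 hx ξ (mt hξ.mem_domain_mul_iff.2 hη)
      · exact transport_of_notMem hη' _
    · rintro ⟨hy, hy'⟩
      obtain ⟨x, hx⟩ := (alphaEquiv K Γ g).surjective ⟨y, hy⟩
      refine ⟨x, mem_idealD_iff.2 fun ξ hξ => ?_, congrArg Subtype.val hx⟩
      by_cases hξ' : ξ ∈ Γ.domain g⁻¹
      · obtain ⟨η, hη⟩ := mem_domain_inv_iff.1 hξ'
        have e : transport K Γ g x.1.1 η = y.1 η :=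
          congrArg (fun z : idealD K Γ g => z.1.1 η) hx
        rw [transport_apply hη] at e
        rw [e]
        exact mem_idealD_iff.1 hy' η (mt hη.mem_domain_mul_iff.1 hξ)
      · exact mem_idealD_iff.1 x.2 ξ hξ'
  comp g h r hr hr' hm := Subtype.ext <| funext fun η => by
    show transport K Γ g (transport K Γ h r.1) η = transport K Γ (g * h) r.1 η
    by_cases hη : η ∈ Γ.domain g
    · obtain ⟨ξ, hξ⟩ := mem_domain_iff.1 hη
      rw [transport_apply hξ]
      by_cases hξ' : ξ ∈ Γ.domain h
      · obtain ⟨μ, hμ⟩ := mem_domain_iff.1 hξ'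
        rw [transport_apply hμ, transport_apply (hμ.trans hξ)]
      · rw [transport_of_notMem hξ', transport_of_notMem (mt hξ.mem_domain_mul_iff.1 hξ')]
    · rw [transport_of_notMem hη]
      by_cases hη' : η ∈ Γ.domain (g * h)
      · obtain ⟨μ, hμ⟩ := mem_domain_iff.1 hη'
        rw [transport_apply hμ]
        refine (mem_idealD_iff.1 hr μ fun hμ' => hη ?_).symm
        obtain ⟨ξ, hξ⟩ := mem_domain_inv_iff.1 hμ'
        exact mem_domain_iff.2 ⟨ξ, by simpa using hξ.inv.trans hμ⟩
      · exact (transport_of_notMem hη' _).symm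

/-- The partial skew group ring `D(X) ⋆ 𝔽`. -/
abbrev SkewRing : Type _ := (freeGroupAction K Γ).SkewGroupRing

theorem char_domain_mem_idealD {g : FreeGroup E} (hg : g ≠ 1) :
    (⟨char K Γ (Γ.domain g), char_domain_mem K Γ hg⟩ : DX K Γ) ∈ (freeGroupAction K Γ).D g :=
  mem_idealD_iff.2 fun _ hη => char_of_notMem hη

theorem mem_D_one (f : DX K Γ) : f ∈ (freeGroupAction K Γ).D 1 :=
  mem_idealD_iff.2 fun _ hη => absurd (Or.inl rfl) hη

/-- The element `1_g δ_g`, for `g ≠ 1`. -/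
noncomputable def oneDelta (g : FreeGroup E) (hg : g ≠ 1) : SkewRing K Γ :=
  PartialAction.SkewGroupRing.single (freeGroupAction K Γ) g
    ⟨⟨char K Γ (Γ.domain g), char_domain_mem K Γ hg⟩, char_domain_mem_idealD K Γ hg⟩

/-- The element `1_v δ_1`, for a vertex `v`. -/
noncomputable def vertexDelta (x : V) : SkewRing K Γ :=
  PartialAction.SkewGroupRing.single (freeGroupAction K Γ) 1
    ⟨⟨char K Γ (Γ.vertexSet x), char_vertexSet_mem K Γ x⟩, mem_D_one K Γ _⟩

variable {K Γ}

/-- `φ` is the isomorphism of `K`-algebras from the Leavitt path algebra onto `D(X) ⋆ 𝔽` with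
`φ(f) = 1_f δ_f`, `φ(f*) = 1_{f⁻¹} δ_{f⁻¹}` and `φ(v) = 1_v δ_1`. -/
structure IsCanonicalIso (φ : LeavittPathAlgebra K Γ →ₙₐ[K] SkewRing K Γ) : Prop where
  bijective : Function.Bijective φ
  edge : ∀ f : E, φ (LeavittPathAlgebra.edge K Γ f) =
    oneDelta K Γ (FreeGroup.of f) (FreeGroup.of_ne_one f)
  ghost : ∀ f : E, φ (LeavittPathAlgebra.ghost K Γ f) =
    oneDelta K Γ (FreeGroup.of f)⁻¹ (inv_ne_one.2 (FreeGroup.of_ne_one f))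
  vertex : ∀ x : V, φ (LeavittPathAlgebra.vertex K Γ x) = vertexDelta K Γ x

/-- The family of subgroups `φ⁻¹(D_g δ_g)`, indexed by the free group on the edges. -/
noncomputable def inducedGrading (φ : LeavittPathAlgebra K Γ →ₙₐ[K] SkewRing K Γ)
    (g : FreeGroup E) : AddSubgroup (LeavittPathAlgebra K Γ) :=
  ((PartialAction.SkewGroupRing.component (freeGroupAction K Γ) g).comap
    (φ : LeavittPathAlgebra K Γ →ₗ[K] SkewRing K Γ)).toAddSubgroup

end DX

end DirectedGraph

/-!
The elements `1_v δ_1`, `1_f δ_f` and `1_{f⁻¹} δ_{f⁻¹}` satisfy the Leavitt relations, which gives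
`φ`, and they generate the skew group ring. For injectivity, let `z` be a combination of monomials
`a b*` of degree `g` with `φ z = 0`; then `z = 0` by induction on the length of the paths `a`.
Indeed left multiplication by `f*` shortens these paths, so that `f* z = 0` for every edge `f`. At
most one path `b` has the degree of `b*` equal to `g`, and as all `f*` kill `z` the product `x z`,
for a vertex `x`, is equal to `c (x b* - ∑ f f* b*)` for every large enough finite set of edges
`f` with source `x`. If `x` emits infinitely many edges, multiplying by `f*` for one left out
gives `c f* b* = 0`; if it emits finitely many but at least one, `x z = 0`; if it is a sink,
`φ (x z) = 0` gives `c x b* = 0`.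

If the vertices lie in the right ideal generated by `D_g δ_g` then `X_g = X`. Each of the three
graded conditions forces this for `g = f` and `g = f⁻¹`, where `f` is any edge: every path in `X`
begins with `f`, and every vertex is `r(f)`. Conversely, if the graph is a single loop then `X` is
one point, and each `D_g δ_g` is a line spanned by the invertible element `1 δ_g`.
-/

/-! ### Group gradings -/

namespace GroupGraded

theorem isInternal_range {ι N : Type*} [DecidableEq ι] [AddCommGroup N]
    {M : ι → Type*} [∀ i, AddCommGroup (M i)] (j : ∀ i, M i →+ N)
    (hj : Function.Bijective (DirectSum.toAddMonoid j)) :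
    DirectSum.IsInternal fun i => (j i).range := by
  have hcomp : (DirectSum.coeAddMonoidHom fun i => (j i).range).comp
      (DirectSum.map fun i => (j i).rangeRestrict) = DirectSum.toAddMonoid j :=
    DirectSum.addHom_ext fun i x => by simp
  rw [← hcomp, AddMonoidHom.coe_comp] at hj
  have hmap : Function.Surjective (DirectSum.map fun i => (j i).rangeRestrict) :=
    (DirectSum.map_surjective _).2 fun i => (j i).rangeRestrict_surjective
  exact ⟨hj.injective.of_comp_right hmap, hj.surjective.of_comp⟩

variable {G R S : Type*} [Group G] [NonUnitalRing R] [NonUnitalRing S] {A : G → AddSubgroup R}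

theorem IsGrading.iSupIndep (hA : IsGrading A) : iSupIndep A := by
  classical
  exact hA.internal.addSubgroup_iSupIndep

theorem IsGrading.eq_zero_or_eq (hA : IsGrading A) {g h : G} {x : R} (hg : x ∈ A g)
    (hh : x ∈ A h) : x = 0 ∨ g = h :=
  or_iff_not_imp_right.2 fun hne =>
    AddSubgroup.disjoint_def.1 (hA.iSupIndep.pairwiseDisjoint hne) hg hh

theorem IsGrading.comap (hA : IsGrading A) (φ : S ≃+* R) :
    IsGrading fun g => (A g).comap (φ : S →+ R) where
  internal := by
    classical
    let j (g : G) : A g →+ S := (φ.symm : R →+ S).comp (A g).subtype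
    have hcomp : DirectSum.toAddMonoid j = (φ.symm : R →+ S).comp (DirectSum.coeAddMonoidHom A) :=
      DirectSum.addHom_ext fun g x => by simp [j]
    have hrange (g : G) : (A g).comap (φ : S →+ R) = (j g).range := by
      ext x
      exact ⟨fun hx => ⟨⟨φ x, hx⟩, φ.symm_apply_apply x⟩, by
        rintro ⟨y, rfl⟩
        exact (congrArg (· ∈ A g) (φ.apply_symm_apply _)).mpr y.2⟩
    simp only [hrange]
    refine isInternal_range j ?_
    rw [hcomp, AddMonoidHom.coe_comp]
    exact φ.symm.bijective.comp hA.internal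
  mul_mem g h x y hx hy := by
    simpa using hA.mul_mem g h (φ x) (φ y) hx hy

/-- `A` is a grading of a graded division ring all of whose components are non-zero: every non-zero
homogeneous element is invertible. The degree of the inverse is part of the definition. -/
structure IsFullGradedDivision (A : G → AddSubgroup R) : Prop where
  isGrading : IsGrading A
  exists_ne_zero : ∀ g, ∃ x ∈ A g, x ≠ 0
  exists_inverse : ∃ e, IsUnity e ∧ ∀ g, ∀ x ∈ A g, x ≠ 0 → ∃ w ∈ A g⁻¹, x * w = e ∧ w * x = e

namespace IsFullGradedDivision

theorem comap (hA : IsFullGradedDivision A) (φ : S ≃+* R) :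
    IsFullGradedDivision fun g => (A g).comap (φ : S →+ R) where
  isGrading := hA.isGrading.comap φ
  exists_ne_zero g := by
    obtain ⟨x, hx, hx0⟩ := hA.exists_ne_zero g
    exact ⟨φ.symm x, by simpa using hx, by simpa using hx0⟩
  exists_inverse := by
    obtain ⟨e, he, hinv⟩ := hA.exists_inverse
    refine ⟨φ.symm e, fun x => ⟨φ.injective ?_, φ.injective ?_⟩, fun g x hx hx0 => ?_⟩
    · simpa using (he (φ x)).1
    · simpa using (he (φ x)).2
    · obtain ⟨w, hw, hxw, hwx⟩ := hinv g (φ x) hx (by simpa using hx0)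
      exact ⟨φ.symm w, by simpa using hw, φ.injective (by simpa using hxw),
        φ.injective (by simpa using hwx)⟩

theorem isStronglyGraded (hA : IsFullGradedDivision A) : IsStronglyGraded A := by
  refine ⟨hA.isGrading, fun g h => le_antisymm ?_ fun z hz => AddSubgroup.subset_closure ?_⟩
  · rw [AddSubgroup.closure_le]
    rintro _ ⟨x, hx, y, hy, rfl⟩
    exact hA.isGrading.mul_mem g h x y hx hy
  · obtain ⟨e, he, hinv⟩ := hA.exists_inverse
    obtain ⟨x, hx, hx0⟩ := hA.exists_ne_zero g
    obtain ⟨w, hw, hxw, -⟩ := hinv g x hx hx0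
    refine ⟨x, hx, w * z, ?_, by rw [← mul_assoc, hxw, (he z).1]⟩
    simpa using hA.isGrading.mul_mem _ _ w z hw hz

theorem isHomogeneous_of_isUnity (hA : IsFullGradedDivision A) {e : R} (he : IsUnity e) :
    IsHomogeneous A e := by
  obtain ⟨e', he', hinv⟩ := hA.exists_inverse
  obtain ⟨x, hx, hx0⟩ := hA.exists_ne_zero 1
  obtain ⟨w, hw, hxw, -⟩ := hinv 1 x hx hx0
  obtain rfl : e = e' := by rw [← (he' e).1, (he e').2]
  exact ⟨_, hxw ▸ hA.isGrading.mul_mem _ _ x w hx hw⟩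

theorem isGradedClean (hA : IsFullGradedDivision A) : IsGradedClean A := by
  obtain ⟨e, he, hinv⟩ := hA.exists_inverse
  refine ⟨hA.isGrading, e, he, ?_⟩
  rintro x ⟨g, hx⟩
  rcases eq_or_ne x 0 with rfl | hx0
  · obtain ⟨h, heh⟩ := hA.isHomogeneous_of_isUnity he
    have hee : e * e = e := (he e).1
    exact ⟨-e, e, ⟨h, neg_mem heh⟩, ⟨-e, by simp [hee]⟩, ⟨h, heh⟩, hee, by simp⟩
  · obtain ⟨w, -, hxw⟩ := hinv g x hx hx0
    exact ⟨x, 0, ⟨g, hx⟩, ⟨w, hxw⟩, ⟨g, zero_mem _⟩, mul_zero 0, (add_zero x).symm⟩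

theorem isGradedUnitRegular (hA : IsFullGradedDivision A) : IsGradedUnitRegular A := by
  obtain ⟨e, he, hinv⟩ := hA.exists_inverse
  refine ⟨hA.isGrading, e, he, ?_⟩
  rintro x ⟨g, hx⟩
  rcases eq_or_ne x 0 with rfl | hx0
  · exact ⟨e, hA.isHomogeneous_of_isUnity he, ⟨e, (he e).1, (he e).1⟩, by simp⟩
  · obtain ⟨w, hw, hxw, hwx⟩ := hinv g x hx hx0
    exact ⟨w, ⟨_, hw⟩, ⟨x, hwx, hxw⟩, by rw [hxw, (he x).1]⟩

end IsFullGradedDivision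

/-- In degree `g ≠ 1` the idempotent summand of a clean decomposition vanishes, because homogeneous
idempotents have degree `1`. -/
theorem IsGradedClean.exists_isInvertible (hA : IsGradedClean A) :
    ∃ e, IsUnity e ∧ ∀ g ≠ 1, ∀ x ∈ A g, x ≠ 0 → IsInvertible e x := by
  obtain ⟨hgr, e, he, hclean⟩ := hA
  refine ⟨e, he, fun g hg x hx hx0 => ?_⟩
  obtain ⟨u, a, ⟨h, hu⟩, hinv, ⟨k, ha⟩, haa, rfl⟩ := hclean x ⟨g, hx⟩
  have ha1 : a ∈ A 1 := by
    rcases hgr.eq_zero_or_eq ha (haa ▸ hgr.mul_mem k k a a ha ha) with rfl | hk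
    · exact zero_mem _
    · rwa [left_eq_mul.1 hk] at ha
  by_cases hgh : h = g
  · subst hgh
    have hah : a ∈ A h := by simpa using sub_mem hx hu
    rcases hgr.eq_zero_or_eq hah ha1 with rfl | h1
    · rwa [add_zero]
    · exact absurd h1 hg
  · have hmem (i : G) (hi : i ≠ g) : A i ≤ ⨆ j ≠ g, A j := le_iSup₂_of_le i hi le_rfl
    exact absurd (AddSubgroup.disjoint_def.1 (hgr.iSupIndep g) hx
      (add_mem (hmem h hgh hu) (hmem 1 hg.symm ha1))) hx0

theorem IsGradedUnitRegular.exists_isInvertible (hA : IsGradedUnitRegular A) :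
    ∃ e, IsUnity e ∧ ∀ g, ∀ x ∈ A g, x ≠ 0 → ∃ u ∈ A g⁻¹, IsInvertible e u := by
  obtain ⟨hgr, e, he, hreg⟩ := hA
  refine ⟨e, he, fun g x hx hx0 => ?_⟩
  obtain ⟨u, ⟨h, hu⟩, hinv, hxux⟩ := hreg x ⟨g, hx⟩
  have hmem := hgr.mul_mem _ _ _ _ (hgr.mul_mem _ _ _ _ hx hu) hx
  rw [← hxux] at hmem
  have hgh : g = g * h * g := (hgr.eq_zero_or_eq hx hmem).resolve_left hx0
  obtain rfl : h = g⁻¹ := (inv_eq_of_mul_eq_one_right (right_eq_mul.1 hgh)).symm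
  exact ⟨u, hu, hinv⟩

end GroupGraded

/-! ### Partial skew group rings -/

namespace PartialAction.SkewGroupRing

variable {K : Type*} {G : Type*} {R : Type*} [CommRing K] [Group G] [NonUnitalRing R] [Module K R]
  (P : PartialAction K G R)

theorem single_injective (g : G) : Function.Injective (single P g) := by
  classical
  exact DirectSum.of_injective (β := fun g => P.D g) g

variable {P} in
theorem induction_on {p : P.SkewGroupRing → Prop} (z : P.SkewGroupRing) (h0 : p 0)
    (hadd : ∀ a b, p a → p b → p (a + b)) (hsingle : ∀ g r, p (single P g r)) : p z := by
  classical
  exact DirectSum.induction_on (motive := p) z h0 hsingle hadd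

variable [IsScalarTower K R R] [SMulCommClass K R R]

theorem component_mul_component {g h : G} {a b : P.SkewGroupRing} (ha : a ∈ component P g)
    (hb : b ∈ component P h) : a * b ∈ component P (g * h) := by
  obtain ⟨r, rfl⟩ := ha
  obtain ⟨r', rfl⟩ := hb
  exact ⟨_, (single_mul_single P g h r r').symm⟩

open Classical in
theorem isInternal_component :
    DirectSum.IsInternal fun g => (component P g).toAddSubgroup := by
  have hid : DirectSum.toAddMonoid (fun g => (single P g).toAddMonoidHom) =
      AddMonoidHom.id P.SkewGroupRing :=
    DirectSum.addHom_ext fun g r => by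
      rw [DirectSum.toAddMonoid_of]
      rfl
  exact GroupGraded.isInternal_range (fun g => (single P g).toAddMonoidHom)
    (by rw [hid]; exact Function.bijective_id)

theorem iSupIndep_component : iSupIndep (component P) := by
  classical
  exact DirectSum.IsInternal.submodule_iSupIndep (isInternal_component P)

end PartialAction.SkewGroupRing

namespace DirectedGraph

variable {V : Type u} {E : Type v}

/-! ### Boundary paths -/

section BoundaryPaths

variable {Γ : DirectedGraph V E}

open BoundaryPath

theorem BoundaryPath.IsCons.source_eq {f : E} {ξ η : BoundaryPath Γ} (h : IsCons f ξ η) :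
    η.source = Γ.s f := by
  obtain ⟨h, rfl⟩ := h
  exact source_cons f ξ h

theorem BoundaryPath.exists_isCons {f : E} {ξ : BoundaryPath Γ} (h : ξ.source = Γ.r f) :
    ∃ η, IsCons f ξ η := ⟨_, h.symm, rfl⟩

theorem BoundaryPath.isSink_or_exists_isCons (η : BoundaryPath Γ) :
    Γ.IsSink η.source ∨ ∃ f ξ, IsCons f ξ η := by
  cases η with
  | finite x a h =>
    obtain ⟨y, hy, hp⟩ := h
    cases a with
    | nil =>
      obtain rfl : x = y := hp
      exact Or.inl hy
    | cons f a =>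
      obtain ⟨rfl, hp⟩ := hp
      exact Or.inr ⟨f, finite (Γ.r f) a ⟨y, hy, hp⟩, rfl, rfl⟩
  | infinite p h =>
    refine Or.inr ⟨p 0, infinite (fun n => p (n + 1)) fun i => h (i + 1), h 0, ?_⟩
    simp only [cons, infinite.injEq]
    funext n
    cases n <;> rfl

/-- A vertex that is not the source of any path in `X` emits an edge to another such vertex;
following these edges forever gives an infinite path. -/
theorem BoundaryPath.exists_source_eq (Γ : DirectedGraph V E) (x : V) :
    ∃ ξ : BoundaryPath Γ, ξ.source = x := by
  by_contra hx
  have hstep (y : {y : V // ¬∃ ξ : BoundaryPath Γ, ξ.source = y}) :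
      ∃ f, Γ.s f = y ∧ ¬∃ ξ : BoundaryPath Γ, ξ.source = Γ.r f := by
    have hy : ¬Γ.IsSink y := fun hs => y.2 ⟨finite y.1 [] ⟨y, hs, rfl⟩, rfl⟩
    simp only [IsSink, not_forall, not_not] at hy
    obtain ⟨f, hf⟩ := hy
    exact ⟨f, hf, fun ⟨ξ, hξ⟩ => y.2 ⟨cons f ξ hξ.symm, (source_cons _ _ _).trans hf⟩⟩
  choose next hs hr using hstep
  let vertexSeq (n : ℕ) : {y : V // ¬∃ ξ : BoundaryPath Γ, ξ.source = y} :=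
    (fun y => ⟨Γ.r (next y), hr y⟩)^[n] ⟨x, hx⟩
  have hpath (n : ℕ) : Γ.r (next (vertexSeq n)) = Γ.s (next (vertexSeq (n + 1))) := by
    rw [hs]
    simp only [vertexSeq, Function.iterate_succ_apply']
  exact hx ⟨infinite (fun n => next (vertexSeq n)) hpath, hs _⟩

open Classical in
theorem theta_of {f : E} {ξ η : BoundaryPath Γ} :
    Γ.Theta (FreeGroup.of f) ξ η ↔ IsCons f ξ η := by
  rw [theta_iff_actRel, FreeGroup.toWord_of]
  simp [ActRel]

theorem theta_of_inv {f : E} {ξ η : BoundaryPath Γ} :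
    Γ.Theta (FreeGroup.of f)⁻¹ η ξ ↔ IsCons f ξ η := by
  rw [← theta_of]
  exact ⟨fun h => by simpa using h.inv, fun h => h.inv⟩

theorem mem_domain_of {f : E} {η : BoundaryPath Γ} :
    η ∈ Γ.domain (FreeGroup.of f) ↔ ∃ ξ, IsCons f ξ η := by
  simp only [mem_domain_iff, theta_of]

theorem mem_domain_of_inv {f : E} {ξ : BoundaryPath Γ} :
    ξ ∈ Γ.domain (FreeGroup.of f)⁻¹ ↔ ξ.source = Γ.r f := by
  simp only [mem_domain_inv_iff, theta_of]
  exact ⟨fun ⟨_, h, _⟩ => h.symm, exists_isCons⟩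

theorem domain_one : Γ.domain 1 = Set.univ := Set.eq_univ_of_forall fun _ => Or.inl rfl

end BoundaryPaths

/-! ### The product of the partial skew group ring -/

section SkewRing

open PartialAction.SkewGroupRing

variable {K : Type w} [Field K] {Γ : DirectedGraph V E}

theorem coeffMul_apply {g h : FreeGroup E} (r : (freeGroupAction K Γ).D g)
    (r' : (freeGroupAction K Γ).D h) :
    ((freeGroupAction K Γ).coeffMul g h r r' : BoundaryPath Γ → K) =
      r.1.1 * transport K Γ g r'.1.1 := by
  change transport K Γ g (transport K Γ g⁻¹ r.1.1 * r'.1.1) = _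
  funext η
  by_cases hη : η ∈ Γ.domain g
  · obtain ⟨ξ, hξ⟩ := mem_domain_iff.1 hη
    rw [transport_apply hξ, Pi.mul_apply, Pi.mul_apply, transport_apply hξ,
      transport_apply hξ.inv]
  · rw [transport_of_notMem hη, Pi.mul_apply, mem_idealD_iff.1 r.2 η hη, zero_mul]

theorem single_congr {g h : FreeGroup E} (hgh : g = h) {r : (freeGroupAction K Γ).D g}
    {r' : (freeGroupAction K Γ).D h} (hr : r.1.1 = r'.1.1) :
    single (freeGroupAction K Γ) g r = single (freeGroupAction K Γ) h r' := by
  subst hgh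
  exact congrArg _ (Subtype.ext (Subtype.ext hr))

theorem single_mul_single_eq {g h k : FreeGroup E} {r : (freeGroupAction K Γ).D g}
    {r' : (freeGroupAction K Γ).D h} {t : (freeGroupAction K Γ).D k} (hk : g * h = k)
    (ht : r.1.1 * transport K Γ g r'.1.1 = t.1.1) :
    single (freeGroupAction K Γ) g r * single (freeGroupAction K Γ) h r' =
      single (freeGroupAction K Γ) k t := by
  rw [single_mul_single]
  exact single_congr hk ((coeffMul_apply r r').trans ht)

/-- The composition law `α_g α_h = α_{gh}`, in the form needed for associativity. -/
theorem transport_mul_transport (g h : FreeGroup E) {a : BoundaryPath Γ → K}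
    (ha : ∀ η, η ∉ Γ.domain g → a η = 0) {b : BoundaryPath Γ → K}
    (hb : ∀ η, η ∉ Γ.domain h → b η = 0) (c : BoundaryPath Γ → K) :
    a * transport K Γ g b * transport K Γ (g * h) c =
      a * transport K Γ g (b * transport K Γ h c) := by
  funext η
  by_cases hη : η ∈ Γ.domain g
  · obtain ⟨ξ, hξ⟩ := mem_domain_iff.1 hη
    simp only [Pi.mul_apply, transport_apply hξ]
    by_cases hξ' : ξ ∈ Γ.domain h
    · obtain ⟨μ, hμ⟩ := mem_domain_iff.1 hξ'
      rw [transport_apply hμ, transport_apply (hμ.trans hξ), mul_assoc]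
    · rw [hb ξ hξ', zero_mul, mul_zero, zero_mul]
  · simp only [Pi.mul_apply, ha η hη, zero_mul]

theorem SkewRing.mul_assoc (a b c : SkewRing K Γ) : a * b * c = a * (b * c) := by
  induction a using PartialAction.SkewGroupRing.induction_on with
  | h0 => simp only [zero_mul]
  | hadd a a' h h' => simp only [add_mul, h, h']
  | hsingle g r =>
    induction b using PartialAction.SkewGroupRing.induction_on with
    | h0 => simp only [zero_mul, mul_zero]
    | hadd b b' h h' => simp only [add_mul, mul_add, h, h']
    | hsingle h r' =>
      induction c using PartialAction.SkewGroupRing.induction_on with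
      | h0 => simp only [mul_zero]
      | hadd c c' h h' => simp only [mul_add, h, h']
      | hsingle k r'' =>
        simp only [single_mul_single]
        refine single_congr (_root_.mul_assoc g h k) ?_
        simp only [coeffMul_apply]
        exact transport_mul_transport g h (mem_idealD_iff.1 r.2) (mem_idealD_iff.1 r'.2) _

noncomputable instance : NonUnitalRing (SkewRing K Γ) where
  mul_assoc := SkewRing.mul_assoc

instance : IsScalarTower K (SkewRing K Γ) (SkewRing K Γ) where
  smul_assoc k a b := by
    simp only [smul_eq_mul, mul_def, map_smul, LinearMap.smul_apply]

instance : SMulCommClass K (SkewRing K Γ) (SkewRing K Γ) where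
  smul_comm k a b := by
    simp only [smul_eq_mul, mul_def, map_smul]

variable (K) in
/-- The element `1_A δ_g`, for a subset `A` of `X_g` whose characteristic function is in `D(X)`.
It is `oneDelta` for `A = X_g`, and `vertexDelta` for `A = X_v` and `g = 1`. -/
noncomputable def charDelta (g : FreeGroup E) (A : Set (BoundaryPath Γ)) (hA : char K Γ A ∈ DX K Γ)
    (hAg : A ⊆ Γ.domain g) : SkewRing K Γ :=
  single (freeGroupAction K Γ) g
    ⟨⟨char K Γ A, hA⟩, mem_idealD_iff.2 fun _ hη => char_of_notMem fun h => hη (hAg h)⟩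

section charDelta

variable {g h k : FreeGroup E} {A B C : Set (BoundaryPath Γ)} {hA : char K Γ A ∈ DX K Γ}
  {hB : char K Γ B ∈ DX K Γ} {hC : char K Γ C ∈ DX K Γ} {hAg : A ⊆ Γ.domain g}
  {hBh : B ⊆ Γ.domain h} {hCk : C ⊆ Γ.domain k}

theorem charDelta_ne_zero (hne : A.Nonempty) : charDelta K g A hA hAg ≠ 0 := by
  intro h
  have hchar : char K Γ A = 0 :=
    congrArg (fun r : (freeGroupAction K Γ).D g => r.1.1)
      ((map_eq_zero_iff _ (single_injective (freeGroupAction K Γ) g)).1 h)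
  obtain ⟨ξ, hξ⟩ := hne
  have hξ0 := congrFun hchar ξ
  rw [char_of_mem hξ] at hξ0
  exact one_ne_zero hξ0

theorem charDelta_mem_component : charDelta K g A hA hAg ∈ component (freeGroupAction K Γ) g :=
  ⟨_, rfl⟩

theorem charDelta_mul_charDelta (hk : g * h = k)
    (hmem : ∀ η, η ∈ C ↔ η ∈ A ∧ ∃ ξ ∈ B, Γ.Theta g ξ η) :
    charDelta K g A hA hAg * charDelta K h B hB hBh = charDelta K k C hC hCk := by
  refine single_mul_single_eq hk (funext fun η => ?_)
  change char K Γ A η * transport K Γ g (char K Γ B) η = char K Γ C η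
  by_cases hη : η ∈ A
  · obtain ⟨ξ, hξ⟩ := mem_domain_iff.1 (hAg hη)
    have hξη : ξ ∈ B ↔ η ∈ C := by
      refine ⟨fun hξB => (hmem η).2 ⟨hη, ξ, hξB, hξ⟩, fun hηC => ?_⟩
      obtain ⟨-, ξ', hξ'B, hξ'⟩ := (hmem η).1 hηC
      rwa [hξ.inv.unique hξ'.inv]
    rw [transport_apply hξ, char_of_mem hη, one_mul]
    exact Set.indicator_eq_indicator hξη rfl
  · rw [char_of_notMem hη, zero_mul, char_of_notMem fun hηC => hη ((hmem η).1 hηC).1]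

theorem charDelta_mul_charDelta_eq_zero (hAB : ∀ η ∈ A, ∀ ξ ∈ B, ¬Γ.Theta g ξ η) :
    charDelta K g A hA hAg * charDelta K h B hB hBh = 0 := by
  have hempty : char K Γ ∅ ∈ DX K Γ := by rw [char_empty]; exact zero_mem _
  rw [charDelta_mul_charDelta (hC := hempty) (hCk := Set.empty_subset _) rfl fun η =>
    ⟨False.elim, fun ⟨hη, ξ, hξ, hξη⟩ => hAB η hη ξ hξ hξη⟩]
  have hzero := map_zero (single (freeGroupAction K Γ) (g * h))
  rw [← hzero]
  exact single_congr rfl char_empty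

end charDelta

/-- The embedding `r ↦ r δ_1` of `D(X)` into the partial skew group ring. -/
noncomputable def deltaOne : DX K Γ →ₗ[K] SkewRing K Γ :=
  single (freeGroupAction K Γ) 1 ∘ₗ LinearMap.id.codRestrict _ (mem_D_one K Γ)

theorem deltaOne_mul_single {g : FreeGroup E} (r : DX K Γ) (t : (freeGroupAction K Γ).D g) :
    deltaOne r * single (freeGroupAction K Γ) g t =
      single (freeGroupAction K Γ) g ⟨r * t, (freeGroupAction K Γ).mul_mem_left g r t t.2⟩ :=
  single_mul_single_eq (one_mul g) (by rw [transport_one]; rfl)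

end SkewRing

/-! ### Leavitt families -/

/-- A Leavitt `E`-family in a `K`-algebra: images `p v`, `e f` and `g f` of the vertices, the edges
and the ghost edges that satisfy the defining relations of the Leavitt path algebra. -/
structure IsLeavittFamily (Γ : DirectedGraph V E) {B : Type*} [NonUnitalNonAssocSemiring B]
    (p : V → B) (e g : E → B) : Prop where
  vertex_idem : ∀ x, p x * p x = p x
  vertex_orth : ∀ x y, x ≠ y → p x * p y = 0
  source_edge : ∀ f, p (Γ.s f) * e f = e f
  edge_range : ∀ f, e f * p (Γ.r f) = e f
  range_ghost : ∀ f, p (Γ.r f) * g f = g f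
  ghost_source : ∀ f, g f * p (Γ.s f) = g f
  ghost_edge : ∀ f, g f * e f = p (Γ.r f)
  ghost_edge_ne : ∀ f f', f ≠ f' → g f * e f' = 0
  sum_edges : ∀ (x : V) (F : Finset E), F.Nonempty → (∀ f, f ∈ F ↔ Γ.s f = x) →
    p x = ∑ f ∈ F, e f * g f

theorem char_vertexSet_eq_sum (K : Type w) [Field K] {Γ : DirectedGraph V E} {x : V} {F : Finset E}
    (hne : F.Nonempty) (hF : ∀ f, f ∈ F ↔ Γ.s f = x) :
    char K Γ (Γ.vertexSet x) = ∑ f ∈ F, char K Γ (Γ.domain (FreeGroup.of f)) := by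
  funext η
  rw [Finset.sum_apply]
  by_cases hη : η.source = x
  · rcases η.isSink_or_exists_isCons with hs | ⟨f, ξ, hf⟩
    · obtain ⟨f, hf⟩ := hne
      exact absurd (((hF f).1 hf).trans hη.symm) (hs f)
    · have hmem : f ∈ F := (hF f).2 (hf.source_eq.symm.trans hη)
      rw [Finset.sum_eq_single_of_mem f hmem, char_of_mem (mem_domain_of.2 ⟨ξ, hf⟩)]
      · exact char_of_mem hη
      · intro f' _ hne'
        refine char_of_notMem fun h => hne' ?_
        obtain ⟨ξ', hξ'⟩ := mem_domain_of.1 h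
        exact (hξ'.inj hf).1
  · rw [char_of_notMem (A := Γ.vertexSet x) hη, Finset.sum_eq_zero]
    refine fun f hf => char_of_notMem fun h => hη ?_
    obtain ⟨ξ, hξ⟩ := mem_domain_of.1 h
    exact hξ.source_eq.trans ((hF f).1 hf)

theorem oneDelta_mul_oneDelta_inv (K : Type w) [Field K] {Γ : DirectedGraph V E} {g : FreeGroup E}
    (hg : g ≠ 1) :
    oneDelta K Γ g hg * oneDelta K Γ g⁻¹ (inv_ne_one.2 hg) =
      deltaOne ⟨_, char_domain_mem K Γ hg⟩ :=
  charDelta_mul_charDelta (hAg := subset_rfl) (hBh := subset_rfl) (hCk := by simp [domain_one])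
    (mul_inv_cancel g) fun η => ⟨fun hη => ⟨hη, by
      obtain ⟨ξ, hξ⟩ := mem_domain_iff.1 hη
      exact ⟨ξ, mem_domain_inv_iff.2 ⟨η, hξ⟩, hξ⟩⟩, And.left⟩

theorem oneDelta_eq_charDelta (K : Type w) [Field K] {Γ : DirectedGraph V E} {g : FreeGroup E}
    (hg : g ≠ 1) :
    oneDelta K Γ g hg = charDelta K g (Γ.domain g) (char_domain_mem K Γ hg) subset_rfl := rfl

theorem vertexDelta_eq_charDelta (K : Type w) [Field K] {Γ : DirectedGraph V E} (x : V) :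
    vertexDelta K Γ x = charDelta K 1 (Γ.vertexSet x) (char_vertexSet_mem K Γ x)
      (by simp only [domain_one, Set.subset_univ]) := rfl

theorem isLeavittFamily_skewRing (K : Type w) [Field K] (Γ : DirectedGraph V E) :
    Γ.IsLeavittFamily (vertexDelta K Γ)
      (fun f => oneDelta K Γ (FreeGroup.of f) (FreeGroup.of_ne_one f))
      (fun f => oneDelta K Γ (FreeGroup.of f)⁻¹ (inv_ne_one.2 (FreeGroup.of_ne_one f))) where
  vertex_idem x := by
    simp only [vertexDelta_eq_charDelta]
    exact charDelta_mul_charDelta (mul_one 1) fun η => by simp [theta_one]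
  vertex_orth x y hxy := by
    simp only [vertexDelta_eq_charDelta]
    exact charDelta_mul_charDelta_eq_zero fun η hη ξ hξ h =>
      hxy (hη.symm.trans ((congrArg _ (theta_one.1 h)).trans hξ))
  source_edge f := by
    simp only [vertexDelta_eq_charDelta, oneDelta_eq_charDelta]
    exact charDelta_mul_charDelta (one_mul _) fun η => by
      simp only [theta_one, exists_eq_right', iff_and_self, mem_domain_of]
      exact fun ⟨ξ, hξ⟩ => hξ.source_eq
  edge_range f := by
    simp only [vertexDelta_eq_charDelta, oneDelta_eq_charDelta]
    exact charDelta_mul_charDelta (mul_one _) fun η => by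
      simp only [mem_domain_of, theta_of, iff_self_and]
      exact fun ⟨ξ, hξ⟩ => ⟨ξ, hξ.1.symm, hξ⟩
  range_ghost f := by
    simp only [vertexDelta_eq_charDelta, oneDelta_eq_charDelta]
    exact charDelta_mul_charDelta (one_mul _) fun ξ => by
      simp only [theta_one, exists_eq_right', iff_and_self, mem_domain_of_inv]
      exact id
  ghost_source f := by
    simp only [vertexDelta_eq_charDelta, oneDelta_eq_charDelta]
    exact charDelta_mul_charDelta (mul_one _) fun ξ => by
      simp only [mem_domain_of_inv, theta_of_inv, iff_self_and]
      exact fun hξ => (BoundaryPath.exists_isCons hξ).imp fun η hη => ⟨hη.source_eq, hη⟩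
  ghost_edge f := by
    simp only [vertexDelta_eq_charDelta, oneDelta_eq_charDelta]
    exact charDelta_mul_charDelta (inv_mul_cancel _) fun ξ => by
      simp only [mem_domain_of, mem_domain_of_inv, theta_of_inv]
      exact ⟨fun hξ => ⟨hξ, (BoundaryPath.exists_isCons hξ).imp fun η hη => ⟨⟨ξ, hη⟩, hη⟩⟩,
        And.left⟩
  ghost_edge_ne f f' hne := by
    simp only [oneDelta_eq_charDelta]
    exact charDelta_mul_charDelta_eq_zero fun ξ _ η hη h => by
      obtain ⟨ξ', hξ'⟩ := mem_domain_of.1 hη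
      exact hne ((theta_of_inv.1 h).inj hξ').1
  sum_edges x F hne hF := by
    simp only [oneDelta_mul_oneDelta_inv, ← map_sum]
    refine congrArg deltaOne (Subtype.ext ((char_vertexSet_eq_sum K hne hF).trans ?_))
    exact (map_sum (NonUnitalSubalgebraClass.subtype (DX K Γ)) (fun f =>
      ⟨_, char_domain_mem K Γ (FreeGroup.of_ne_one f)⟩) F).symm

/-! ### The universal property of the Leavitt path algebra -/

namespace LeavittPathAlgebra

variable {K : Type w} [Field K] {Γ : DirectedGraph V E}

instance : IsScalarTower K (LeavittPathAlgebra K Γ) (LeavittPathAlgebra K Γ) where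
  smul_assoc k a b := by
    obtain ⟨a, rfl⟩ := mk_surjective K Γ a
    obtain ⟨b, rfl⟩ := mk_surjective K Γ b
    simp only [smul_eq_mul, ← mk_smul, ← mk_mul, smul_mul_assoc]

instance : SMulCommClass K (LeavittPathAlgebra K Γ) (LeavittPathAlgebra K Γ) where
  smul_comm k a b := by
    obtain ⟨a, rfl⟩ := mk_surjective K Γ a
    obtain ⟨b, rfl⟩ := mk_surjective K Γ b
    simp only [smul_eq_mul, ← mk_smul, ← mk_mul, mul_smul_comm]

variable (K Γ) in
/-- The quotient map from the free algebra, as an algebra homomorphism. -/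
noncomputable def mkHom : FreeAlg K V E →ₙₐ[K] LeavittPathAlgebra K Γ where
  toFun := mk K Γ
  map_smul' := mk_smul K Γ
  map_zero' := mk_zero K Γ
  map_add' := mk_add K Γ
  map_mul' := mk_mul K Γ

theorem hom_ext {B : Type*} [NonUnitalSemiring B] [Module K B]
    {φ ψ : LeavittPathAlgebra K Γ →ₙₐ[K] B} (hv : ∀ x, φ (vertex K Γ x) = ψ (vertex K Γ x))
    (he : ∀ f, φ (edge K Γ f) = ψ (edge K Γ f)) (hg : ∀ f, φ (ghost K Γ f) = ψ (ghost K Γ f)) :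
    φ = ψ := by
  have hcomp : φ.comp (mkHom K Γ) = ψ.comp (mkHom K Γ) := by
    refine MonoidAlgebra.nonUnitalAlgHom_ext' K (FreeSemigroup.hom_ext (funext fun x => ?_))
    cases x
    · exact hv _
    · exact he _
    · exact hg _
  refine NonUnitalAlgHom.ext fun a => ?_
  obtain ⟨a, rfl⟩ := mk_surjective K Γ a
  exact DFunLike.congr_fun hcomp a

theorem mk_eq_of_rel {a b : FreeAlg K V E} (h : LeavittRel K Γ a b) : mk K Γ a = mk K Γ b :=
  (mk_eq K Γ).2 (RingConGen.Rel.of _ _ ⟨1, a, b, h, (one_smul K a).symm, (one_smul K b).symm⟩)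

variable (K Γ) in
theorem isLeavittFamily : Γ.IsLeavittFamily (vertex K Γ) (edge K Γ) (ghost K Γ) where
  vertex_idem x := mk_eq_of_rel (.vertex_idem x)
  vertex_orth x y h := mk_eq_of_rel (.vertex_orth x y h)
  source_edge f := mk_eq_of_rel (.source_edge f)
  edge_range f := mk_eq_of_rel (.edge_range f)
  range_ghost f := mk_eq_of_rel (.range_ghost f)
  ghost_source f := mk_eq_of_rel (.ghost_source f)
  ghost_edge f := mk_eq_of_rel (.ghost_edge f)
  ghost_edge_ne f f' h := mk_eq_of_rel (.ghost_edge_ne f f' h)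
  sum_edges x F hne hF :=
    (mk_eq_of_rel (.sum_edges x F hne hF)).trans (map_sum (mkHom K Γ) _ F)

end LeavittPathAlgebra

section lift

variable (K : Type w) [Field K] {Γ : DirectedGraph V E} {B : Type*} [NonUnitalSemiring B]
  [Module K B] [IsScalarTower K B B] [SMulCommClass K B B] {p : V → B} {e g : E → B}

/-- The homomorphism from the free algebra given by the images of the generators. -/
noncomputable def freeLift (p : V → B) (e g : E → B) : FreeAlg K V E →ₙₐ[K] B :=
  MonoidAlgebra.liftMagma K <| FreeSemigroup.lift fun
    | Gen.vertex x => p x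
    | Gen.edge f => e f
    | Gen.ghost f => g f

theorem freeLift_vertex (x : V) : freeLift K p e g (gen K (Gen.vertex x)) = p x := by
  simp [freeLift, gen, MonoidAlgebra.liftMagma]

theorem freeLift_edge (f : E) : freeLift K p e g (gen K (Gen.edge f)) = e f := by
  simp [freeLift, gen, MonoidAlgebra.liftMagma]

theorem freeLift_ghost (f : E) : freeLift K p e g (gen K (Gen.ghost f)) = g f := by
  simp [freeLift, gen, MonoidAlgebra.liftMagma]

variable {K}

namespace IsLeavittFamily

theorem freeLift_rel (h : Γ.IsLeavittFamily p e g) {a b : FreeAlg K V E}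
    (hab : LeavittRel K Γ a b) : freeLift K p e g a = freeLift K p e g b := by
  cases hab <;>
    simp only [map_mul, map_zero, map_sum, freeLift_vertex, freeLift_edge, freeLift_ghost]
  case vertex_idem x => exact h.vertex_idem x
  case vertex_orth x y hxy => exact h.vertex_orth x y hxy
  case source_edge f => exact h.source_edge f
  case edge_range f => exact h.edge_range f
  case range_ghost f => exact h.range_ghost f
  case ghost_source f => exact h.ghost_source f
  case ghost_edge f => exact h.ghost_edge f
  case ghost_edge_ne f f' hne => exact h.ghost_edge_ne f f' hne
  case sum_edges x F hne hF => exact h.sum_edges x F hne hF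

theorem freeLift_con (h : Γ.IsLeavittFamily p e g) {a b : FreeAlg K V E}
    (hab : leavittCon K Γ a b) : freeLift K p e g a = freeLift K p e g b := by
  have hle : leavittCon K Γ ≤ (⊥ : RingCon B).comap (freeLift K p e g) := by
    refine RingCon.ringConGen_le.2 ?_
    rintro _ _ ⟨k, a, b, hab, rfl, rfl⟩
    change freeLift K p e g (k • a) = freeLift K p e g (k • b)
    rw [map_smul, map_smul, h.freeLift_rel hab]
  exact hle hab

variable (K) in
/-- The homomorphism from the Leavitt path algebra that corresponds to a Leavitt family. -/
noncomputable def lift (h : Γ.IsLeavittFamily p e g) : LeavittPathAlgebra K Γ →ₙₐ[K] B where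
  toFun := Quotient.lift (freeLift K p e g) fun _ _ => h.freeLift_con
  map_zero' := map_zero (freeLift K p e g)
  map_smul' k a := by
    obtain ⟨a, rfl⟩ := LeavittPathAlgebra.mk_surjective K Γ a
    exact map_smul (freeLift K p e g) k a
  map_add' a b := by
    obtain ⟨a, rfl⟩ := LeavittPathAlgebra.mk_surjective K Γ a
    obtain ⟨b, rfl⟩ := LeavittPathAlgebra.mk_surjective K Γ b
    exact map_add (freeLift K p e g) a b
  map_mul' a b := by
    obtain ⟨a, rfl⟩ := LeavittPathAlgebra.mk_surjective K Γ a
    obtain ⟨b, rfl⟩ := LeavittPathAlgebra.mk_surjective K Γ b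
    exact map_mul (freeLift K p e g) a b

theorem lift_vertex (h : Γ.IsLeavittFamily p e g) (x : V) :
    h.lift K (LeavittPathAlgebra.vertex K Γ x) = p x := freeLift_vertex K x

theorem lift_edge (h : Γ.IsLeavittFamily p e g) (f : E) :
    h.lift K (LeavittPathAlgebra.edge K Γ f) = e f := freeLift_edge K f

theorem lift_ghost (h : Γ.IsLeavittFamily p e g) (f : E) :
    h.lift K (LeavittPathAlgebra.ghost K Γ f) = g f := freeLift_ghost K f

end IsLeavittFamily

end lift

open Filter

/-! ### Monomials in the Leavitt path algebra -/

namespace LeavittPathAlgebra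

variable (K : Type w) [Field K] (Γ : DirectedGraph V E)

/-- The element `x b*`, for a vertex `x` and a list `b` of edges. It is zero unless `b` is a path
with range `x`. -/
noncomputable def ghostPath (x : V) : List E → LeavittPathAlgebra K Γ
  | [] => vertex K Γ x
  | f :: b => ghostPath x b * ghost K Γ f

/-- The element `a x b*`, for a vertex `x` and lists `a` and `b` of edges. It is zero unless `a` and
`b` are paths with range `x`. -/
noncomputable def monomial (a : List E) (x : V) (b : List E) : LeavittPathAlgebra K Γ :=
  match a with
  | [] => ghostPath K Γ x b
  | f :: a => edge K Γ f * monomial a x b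

variable {K Γ}

theorem ghost_mul_vertex_of_ne {f : E} {x : V} (h : Γ.s f ≠ x) :
    ghost K Γ f * vertex K Γ x = 0 := by
  rw [← (isLeavittFamily K Γ).ghost_source f, mul_assoc,
    (isLeavittFamily K Γ).vertex_orth _ _ h, mul_zero]

theorem vertex_mul_ghostPath_self (x : V) (b : List E) :
    vertex K Γ x * ghostPath K Γ x b = ghostPath K Γ x b := by
  induction b with
  | nil => exact (isLeavittFamily K Γ).vertex_idem x
  | cons f b ih => rw [ghostPath, ← mul_assoc, ih]

theorem vertex_mul_ghostPath_of_ne {x y : V} (h : y ≠ x) (b : List E) :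
    vertex K Γ y * ghostPath K Γ x b = 0 := by
  rw [← vertex_mul_ghostPath_self, ← mul_assoc, (isLeavittFamily K Γ).vertex_orth _ _ h, zero_mul]

theorem exists_vertex_mul_monomial (a : List E) (x : V) (b : List E) :
    ∃ y, vertex K Γ y * monomial K Γ a x b = monomial K Γ a x b := by
  cases a with
  | nil => exact ⟨x, vertex_mul_ghostPath_self x b⟩
  | cons f a => exact ⟨Γ.s f, by rw [monomial, ← mul_assoc, (isLeavittFamily K Γ).source_edge]⟩

theorem vertex_mul_monomial (y : V) (a : List E) (x : V) (b : List E) :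
    vertex K Γ y * monomial K Γ a x b = monomial K Γ a x b ∨
      vertex K Γ y * monomial K Γ a x b = 0 := by
  obtain ⟨y', hy'⟩ := exists_vertex_mul_monomial (K := K) (Γ := Γ) a x b
  rcases eq_or_ne y y' with rfl | h
  · exact Or.inl hy'
  · refine Or.inr ?_
    rw [← hy', ← mul_assoc, (isLeavittFamily K Γ).vertex_orth _ _ h, zero_mul]

theorem ghost_mul_ghostPath_source (f : E) (b : List E) :
    ghost K Γ f * ghostPath K Γ (Γ.s f) b = ghostPath K Γ (Γ.r f) (b ++ [f]) := by
  induction b with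
  | nil =>
    exact ((isLeavittFamily K Γ).ghost_source f).trans ((isLeavittFamily K Γ).range_ghost f).symm
  | cons f' b ih => rw [ghostPath, ← mul_assoc, ih, List.cons_append, ghostPath]

theorem ghost_mul_ghostPath_of_ne {f : E} {x : V} (h : Γ.s f ≠ x) (b : List E) :
    ghost K Γ f * ghostPath K Γ x b = 0 := by
  rw [← vertex_mul_ghostPath_self, ← mul_assoc, ghost_mul_vertex_of_ne h, zero_mul]

theorem ghost_mul_monomial_cons (f f' : E) (a : List E) (x : V) (b : List E) :
    ghost K Γ f * monomial K Γ (f' :: a) x b = 0 ∨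
      f = f' ∧ ghost K Γ f * monomial K Γ (f' :: a) x b = monomial K Γ a x b := by
  rw [monomial, ← mul_assoc]
  rcases eq_or_ne f f' with rfl | h
  · rw [(isLeavittFamily K Γ).ghost_edge]
    exact (vertex_mul_monomial _ a x b).symm.imp_right fun h => ⟨rfl, h⟩
  · rw [(isLeavittFamily K Γ).ghost_edge_ne f f' h, zero_mul]
    exact Or.inl rfl

theorem ghostPath_mul_vertex (x : V) (b : List E) (y : V) :
    ghostPath K Γ x b * vertex K Γ y = ghostPath K Γ x b ∨
      ghostPath K Γ x b * vertex K Γ y = 0 := by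
  cases b with
  | nil =>
    rcases eq_or_ne x y with rfl | h
    · exact Or.inl ((isLeavittFamily K Γ).vertex_idem x)
    · exact Or.inr ((isLeavittFamily K Γ).vertex_orth x y h)
  | cons f b =>
    rw [ghostPath, mul_assoc]
    rcases eq_or_ne (Γ.s f) y with rfl | h
    · rw [(isLeavittFamily K Γ).ghost_source]
      exact Or.inl rfl
    · rw [ghost_mul_vertex_of_ne h, mul_zero]
      exact Or.inr rfl

theorem ghostPath_eq_zero_or_exists_mul_eq (x : V) (b : List E) :
    ghostPath K Γ x b = 0 ∨ ∃ t, ghostPath K Γ x b * t = vertex K Γ x := by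
  induction b with
  | nil => exact Or.inr ⟨_, (isLeavittFamily K Γ).vertex_idem x⟩
  | cons f b ih =>
    rcases ih with h0 | ⟨t, ht⟩
    · exact Or.inl (by rw [ghostPath, h0, zero_mul])
    rcases ghostPath_mul_vertex (K := K) x b (Γ.r f) with h | h
    · refine Or.inr ⟨edge K Γ f * t, ?_⟩
      rw [ghostPath, mul_assoc, ← mul_assoc (ghost K Γ f), (isLeavittFamily K Γ).ghost_edge,
        ← mul_assoc, h, ht]
    · refine Or.inl ?_
      rw [ghostPath, ← (isLeavittFamily K Γ).range_ghost, ← mul_assoc, h, zero_mul]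

variable (K Γ) in
/-- The set of all elements `a x b*`. -/
def monomials : Set (LeavittPathAlgebra K Γ) := {z | ∃ a x b, z = monomial K Γ a x b}

theorem gen_mem_span_monomials (γ : Gen V E) :
    mk K Γ (gen K γ) ∈ Submodule.span K (monomials K Γ) := by
  apply Submodule.subset_span
  cases γ with
  | vertex x => exact ⟨[], x, [], rfl⟩
  | edge f => exact ⟨[f], Γ.r f, [], ((isLeavittFamily K Γ).edge_range f).symm⟩
  | ghost f => exact ⟨[], Γ.r f, [f], ((isLeavittFamily K Γ).range_ghost f).symm⟩

theorem gen_mul_monomial (γ : Gen V E) {z : LeavittPathAlgebra K Γ} (hz : z ∈ monomials K Γ) :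
    mk K Γ (gen K γ) * z = 0 ∨ mk K Γ (gen K γ) * z ∈ monomials K Γ := by
  obtain ⟨a, x, b, rfl⟩ := hz
  cases γ with
  | vertex y => exact (vertex_mul_monomial y a x b).symm.imp_right fun h => ⟨a, x, b, h⟩
  | edge f => exact Or.inr ⟨f :: a, x, b, rfl⟩
  | ghost f =>
    cases a with
    | nil =>
      rcases eq_or_ne (Γ.s f) x with rfl | h
      · exact Or.inr ⟨[], Γ.r f, b ++ [f], ghost_mul_ghostPath_source f b⟩
      · exact Or.inl (ghost_mul_ghostPath_of_ne h b)
    | cons f' a =>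
      exact (ghost_mul_monomial_cons f f' a x b).imp_right fun h => ⟨a, x, b, h.2⟩

theorem gen_mul_mem_span_monomials (γ : Gen V E) {z : LeavittPathAlgebra K Γ}
    (hz : z ∈ Submodule.span K (monomials K Γ)) :
    mk K Γ (gen K γ) * z ∈ Submodule.span K (monomials K Γ) := by
  have hle : Submodule.span K (monomials K Γ) ≤ (Submodule.span K (monomials K Γ)).comap
      (LinearMap.mulLeft K (mk K Γ (gen K γ))) := by
    rw [Submodule.span_le]
    intro z hz
    change mk K Γ (gen K γ) * z ∈ Submodule.span K (monomials K Γ)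
    rcases gen_mul_monomial γ hz with h | h
    · exact h ▸ zero_mem _
    · exact Submodule.subset_span h
  exact hle hz

theorem span_monomials : Submodule.span K (monomials K Γ) = ⊤ := by
  have hword (s : FreeSemigroup (Gen V E)) :
      mk K Γ (MonoidAlgebra.single s 1) ∈ Submodule.span K (monomials K Γ) := by
    induction s using FreeSemigroup.recOnMul with
    | ih1 γ => exact gen_mem_span_monomials γ
    | ih2 γ s _ h =>
      have hmul : (MonoidAlgebra.single (FreeSemigroup.of γ * s) 1 : FreeAlg K V E) =
          gen K γ * MonoidAlgebra.single s 1 := by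
        rw [gen, MonoidAlgebra.single_mul_single, one_mul]
      rw [hmul, mk_mul]
      exact gen_mul_mem_span_monomials γ h
  refine Submodule.eq_top_iff'.2 fun z => ?_
  obtain ⟨z, rfl⟩ := mk_surjective K Γ z
  induction z using MonoidAlgebra.induction_linear with
  | zero => exact zero_mem _
  | add z z' h h' => exact add_mem h h'
  | single s k =>
    have hsmul : (MonoidAlgebra.single s k : FreeAlg K V E) = k • MonoidAlgebra.single s 1 := by
      rw [MonoidAlgebra.smul_single, smul_eq_mul, mul_one]
    rw [hsmul, mk_smul]
    exact Submodule.smul_mem _ k (hword s)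

open Classical in
theorem eventually_sum_vertex_mul (z : LeavittPathAlgebra K Γ) :
    ∀ᶠ T : Finset V in atTop, (∑ x ∈ T, vertex K Γ x) * z = z := by
  have hz : z ∈ Submodule.span K (monomials K Γ) := by
    rw [span_monomials]
    exact Submodule.mem_top
  induction hz using Submodule.span_induction with
  | mem z hz =>
    obtain ⟨a, x, b, rfl⟩ := hz
    obtain ⟨y, hy⟩ := exists_vertex_mul_monomial (K := K) (Γ := Γ) a x b
    filter_upwards [eventually_ge_atTop {y}] with T hT
    rw [← hy, ← mul_assoc, Finset.sum_mul,
      Finset.sum_eq_single_of_mem y (Finset.singleton_subset_iff.1 hT),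
      (isLeavittFamily K Γ).vertex_idem]
    exact fun x _ hx => (isLeavittFamily K Γ).vertex_orth x y hx
  | zero => exact Eventually.of_forall fun T => mul_zero _
  | add z z' _ _ h h' =>
    filter_upwards [h, h'] with T hT hT'
    rw [mul_add, hT, hT']
  | smul k z _ h =>
    filter_upwards [h] with T hT
    rw [mul_smul_comm, hT]

theorem eq_zero_of_vertex_mul_eq_zero {z : LeavittPathAlgebra K Γ}
    (hz : ∀ x, vertex K Γ x * z = 0) : z = 0 := by
  classical
  obtain ⟨T, hT⟩ := (eventually_sum_vertex_mul z).exists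
  rw [← hT, Finset.sum_mul, Finset.sum_eq_zero fun x _ => hz x]

end LeavittPathAlgebra

/-! ### The graded uniqueness theorem -/

/-- The element of the free group given by a path. -/
def pathElt (a : List E) : FreeGroup E := FreeGroup.mk (pathWord a [])

theorem pathElt_nil : pathElt ([] : List E) = 1 := rfl

theorem pathElt_cons (f : E) (a : List E) : pathElt (f :: a) = FreeGroup.of f * pathElt a := rfl

theorem pathElt_append (a b : List E) : pathElt (a ++ b) = pathElt a * pathElt b := by
  induction a with
  | nil => rw [List.nil_append, pathElt_nil, one_mul]
  | cons f a ih => rw [List.cons_append, pathElt_cons, pathElt_cons, ih, mul_assoc]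

theorem pathElt_injective : Function.Injective (pathElt (E := E)) := by
  classical
  intro a b hab
  have hword := congrArg FreeGroup.toWord hab
  simp only [pathElt, FreeGroup.toWord_mk, (isReduced_pathWord_nil_right _).reduce_eq] at hword
  exact (pathWord_inj hword).1

theorem exists_forall_pathElt_inv_eq (g : FreeGroup E) :
    ∃ b : List E, ∀ b', (pathElt b')⁻¹ = g → b' = b := by
  by_cases hg : ∃ b : List E, (pathElt b)⁻¹ = g
  · obtain ⟨b, rfl⟩ := hg
    exact ⟨b, fun b' hb' => pathElt_injective (inv_injective hb')⟩
  · exact ⟨[], fun b' hb' => absurd ⟨b', hb'⟩ hg⟩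

namespace LeavittPathAlgebra

variable {K : Type w} [Field K] {Γ : DirectedGraph V E}

variable (K Γ) in
/-- The span of the monomials `a x b*` of degree `g` in which `a` has length at most `n`. -/
noncomputable def degreeFiltration (g : FreeGroup E) (n : ℕ) :
    Submodule K (LeavittPathAlgebra K Γ) :=
  Submodule.span K
    {z | ∃ a x b, a.length ≤ n ∧ pathElt a * (pathElt b)⁻¹ = g ∧ z = monomial K Γ a x b}

theorem degreeFiltration_mono (g : FreeGroup E) : Monotone (degreeFiltration K Γ g) :=
  fun _ _ h => Submodule.span_mono fun _ ⟨a, x, b, ha, hz⟩ => ⟨a, x, b, ha.trans h, hz⟩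

theorem iSup_degreeFiltration : ⨆ g, ⨆ n, degreeFiltration K Γ g n = ⊤ := by
  rw [← top_le_iff, ← span_monomials, Submodule.span_le]
  rintro _ ⟨a, x, b, rfl⟩
  exact Submodule.mem_iSup_of_mem _
    (Submodule.mem_iSup_of_mem a.length (Submodule.subset_span ⟨a, x, b, le_rfl, rfl, rfl⟩))

theorem ghost_mul_mem_degreeFiltration (f : E) {g : FreeGroup E} {n : ℕ}
    {z : LeavittPathAlgebra K Γ} (hz : z ∈ degreeFiltration K Γ g (n + 1)) :
    ghost K Γ f * z ∈ degreeFiltration K Γ ((FreeGroup.of f)⁻¹ * g) n := by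
  induction hz using Submodule.span_induction with
  | zero => simp only [mul_zero, zero_mem]
  | add z z' _ _ h h' => simpa only [mul_add] using add_mem h h'
  | smul k z _ h => simpa only [mul_smul_comm] using Submodule.smul_mem _ k h
  | mem z hz =>
    obtain ⟨a, x, b, ha, rfl, rfl⟩ := hz
    cases a with
    | nil =>
      rcases eq_or_ne (Γ.s f) x with rfl | h
      · refine Submodule.subset_span ⟨[], Γ.r f, b ++ [f], n.zero_le, ?_,
          ghost_mul_ghostPath_source f b⟩
        rw [pathElt_append, pathElt_cons, pathElt_nil]
        group
      · rw [monomial, ghost_mul_ghostPath_of_ne h]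
        exact zero_mem _
    | cons f' a =>
      rcases ghost_mul_monomial_cons (K := K) (Γ := Γ) f f' a x b with h | ⟨rfl, h⟩
      · rw [h]
        exact zero_mem _
      · rw [h]
        refine Submodule.subset_span ⟨a, x, b, Nat.le_of_succ_le_succ ha, ?_, rfl⟩
        rw [pathElt_cons]
        group

variable (K Γ) in
/-- The idempotent `∑ f f*`, for a finite set of edges `f`. -/
noncomputable def edgeProjection (F : Finset E) : LeavittPathAlgebra K Γ :=
  ∑ f ∈ F, edge K Γ f * ghost K Γ f

theorem edgeProjection_mul_eq_zero (F : Finset E) {z : LeavittPathAlgebra K Γ}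
    (hz : ∀ f, ghost K Γ f * z = 0) : edgeProjection K Γ F * z = 0 := by
  rw [edgeProjection, Finset.sum_mul]
  exact Finset.sum_eq_zero fun f _ => by rw [mul_assoc, hz, mul_zero]

theorem ghost_mul_edgeProjection_of_notMem {f : E} {F : Finset E} (hf : f ∉ F) :
    ghost K Γ f * edgeProjection K Γ F = 0 := by
  rw [edgeProjection, Finset.mul_sum]
  refine Finset.sum_eq_zero fun f' hf' => ?_
  rw [← mul_assoc, (isLeavittFamily K Γ).ghost_edge_ne f f' fun h => hf (h ▸ hf'), zero_mul]

theorem edgeProjection_mul_edge {f : E} {F : Finset E} (hf : f ∈ F) :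
    edgeProjection K Γ F * edge K Γ f = edge K Γ f := by
  rw [edgeProjection, Finset.sum_mul, Finset.sum_eq_single_of_mem f hf, mul_assoc,
    (isLeavittFamily K Γ).ghost_edge, (isLeavittFamily K Γ).edge_range]
  intro f' _ hne
  rw [mul_assoc, (isLeavittFamily K Γ).ghost_edge_ne f' f hne, mul_zero]

open Classical in
theorem edgeProjection_mul_vertex (F : Finset E) (x : V) :
    edgeProjection K Γ F * vertex K Γ x = edgeProjection K Γ {f ∈ F | Γ.s f = x} := by
  rw [edgeProjection, Finset.sum_mul, edgeProjection, Finset.sum_filter]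
  refine Finset.sum_congr rfl fun f _ => ?_
  split_ifs with h
  · rw [mul_assoc, ← h, (isLeavittFamily K Γ).ghost_source]
  · rw [mul_assoc, ghost_mul_vertex_of_ne h, mul_zero]

theorem edgeProjection_mul_vertex_of_subset {F : Finset E} {x : V}
    (hF : {f | Γ.s f = x} ⊆ (F : Set E)) :
    edgeProjection K Γ F * vertex K Γ x = vertex K Γ x ∨
      edgeProjection K Γ F * vertex K Γ x = 0 := by
  classical
  rw [edgeProjection_mul_vertex]
  rcases Finset.eq_empty_or_nonempty {f ∈ F | Γ.s f = x} with h | h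
  · exact Or.inr (by rw [h, edgeProjection, Finset.sum_empty])
  · refine Or.inl ((isLeavittFamily K Γ).sum_edges x _ h fun f => ?_).symm
    rw [Finset.mem_filter]
    exact ⟨And.right, fun hf => ⟨hF hf, hf⟩⟩

/-- At most one path `b` has the degree of `b*` equal to `g`, so `x z` is a multiple of `x b*` up to
a combination of monomials that begin with an edge. -/
theorem exists_eventually_edgeProjection_mul {g : FreeGroup E} {n : ℕ}
    {z : LeavittPathAlgebra K Γ} (hz : z ∈ degreeFiltration K Γ g n) {b : List E}
    (hb : ∀ b', (pathElt b')⁻¹ = g → b' = b) (x : V) :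
    ∃ c : K, ∀ᶠ F in atTop, edgeProjection K Γ F *
      (vertex K Γ x * z - c • ghostPath K Γ x b) = vertex K Γ x * z - c • ghostPath K Γ x b := by
  classical
  induction hz using Submodule.span_induction with
  | zero => exact ⟨0, Eventually.of_forall fun F => by simp only [mul_zero, zero_smul, sub_zero]⟩
  | add z z' _ _ h h' =>
    obtain ⟨c, hc⟩ := h
    obtain ⟨c', hc'⟩ := h'
    refine ⟨c + c', ?_⟩
    filter_upwards [hc, hc'] with F hF hF'
    rw [mul_add, add_smul, add_sub_add_comm, mul_add, hF, hF']
  | smul k z _ h =>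
    obtain ⟨c, hc⟩ := h
    refine ⟨k * c, ?_⟩
    filter_upwards [hc] with F hF
    rw [mul_smul_comm, mul_smul, ← smul_sub, mul_smul_comm, hF]
  | mem z hz =>
    obtain ⟨a, y, b', -, hg, rfl⟩ := hz
    cases a with
    | nil =>
      obtain rfl := hb b' ((one_mul _).symm.trans hg)
      rcases eq_or_ne x y with rfl | h
      · exact ⟨1, Eventually.of_forall fun F => by
          rw [monomial, vertex_mul_ghostPath_self, one_smul, sub_self, mul_zero]⟩
      · exact ⟨0, Eventually.of_forall fun F => by
          rw [monomial, vertex_mul_ghostPath_of_ne h, zero_smul, sub_self, mul_zero]⟩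
    | cons f a =>
      refine ⟨0, ?_⟩
      filter_upwards [eventually_ge_atTop {f}] with F hF
      rw [zero_smul, sub_zero]
      rcases vertex_mul_monomial (K := K) (Γ := Γ) x (f :: a) y b' with h | h
      · rw [h, monomial, ← mul_assoc,
          edgeProjection_mul_edge (Finset.singleton_subset_iff.1 hF)]
      · rw [h, mul_zero]

theorem exists_vertex_mul_eq_smul {g : FreeGroup E} {z : LeavittPathAlgebra K Γ}
    (hz : z ∈ degreeFiltration K Γ g 0) {b : List E}
    (hb : ∀ b', (pathElt b')⁻¹ = g → b' = b) (x : V) :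
    ∃ c : K, vertex K Γ x * z = c • ghostPath K Γ x b := by
  induction hz using Submodule.span_induction with
  | zero => exact ⟨0, by rw [mul_zero, zero_smul]⟩
  | add z z' _ _ h h' =>
    obtain ⟨c, hc⟩ := h
    obtain ⟨c', hc'⟩ := h'
    exact ⟨c + c', by rw [mul_add, hc, hc', add_smul]⟩
  | smul k z _ h =>
    obtain ⟨c, hc⟩ := h
    exact ⟨k * c, by rw [mul_smul_comm, hc, mul_smul]⟩
  | mem z hz =>
    obtain ⟨a, y, b', ha, hg, rfl⟩ := hz
    obtain rfl := List.length_eq_zero_iff.1 (Nat.le_zero.1 ha)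
    obtain rfl := hb b' ((one_mul _).symm.trans hg)
    rcases eq_or_ne x y with rfl | h
    · exact ⟨1, by rw [monomial, vertex_mul_ghostPath_self, one_smul]⟩
    · exact ⟨0, by rw [monomial, vertex_mul_ghostPath_of_ne h, zero_smul]⟩

end LeavittPathAlgebra

theorem injective_of_iSupIndep {ι R M N : Type*} [Ring R] [AddCommGroup M] [Module R M]
    [AddCommGroup N] [Module R N] (φ : M →ₗ[R] N) {A : ι → Submodule R M} {B : ι → Submodule R N}
    (hA : ⨆ i, A i = ⊤) (hB : iSupIndep B) (hAB : ∀ i, ∀ x ∈ A i, φ x ∈ B i)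
    (hφ : ∀ i, ∀ x ∈ A i, φ x = 0 → x = 0) : Function.Injective φ := by
  refine (injective_iff_map_eq_zero φ).2 fun x hx => ?_
  have hxA : x ∈ ⨆ i, A i := hA ▸ Submodule.mem_top
  obtain ⟨f, hf, rfl⟩ := (Submodule.mem_iSup_iff_exists_finsupp A x).1 hxA
  rw [map_finsuppSum] at hx
  exact Finset.sum_eq_zero fun i hi => hφ i _ (hf i)
    ((iSupIndep_iff_finsetSum_eq_zero_imp_eq_zero B).1 hB f.support (fun i => φ (f i))
      (fun i _ => hAB i _ (hf i)) hx i hi)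

namespace LeavittPathAlgebra

variable {K : Type w} [Field K] {Γ : DirectedGraph V E} {B : Type*} [NonUnitalNonAssocRing B]
  [Module K B] {φ : LeavittPathAlgebra K Γ →ₙₐ[K] B}

section

variable (hφ : ∀ x, φ (vertex K Γ x) ≠ 0)
include hφ

theorem eq_zero_of_map_smul_vertex {c : K} {x : V} (h : φ (c • vertex K Γ x) = 0) : c = 0 := by
  rw [map_smul] at h
  exact (smul_eq_zero.1 h).resolve_right (hφ x)

theorem smul_ghostPath_eq_zero_of_map {c : K} {x : V} {b : List E}
    (h : φ (c • ghostPath K Γ x b) = 0) : c • ghostPath K Γ x b = 0 := by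
  rcases ghostPath_eq_zero_or_exists_mul_eq (K := K) (Γ := Γ) x b with h0 | ⟨t, ht⟩
  · rw [h0, smul_zero]
  · have hc : c = 0 := eq_zero_of_map_smul_vertex hφ (c := c) (x := x)
      (by rw [← ht, ← smul_mul_assoc, map_mul, h, zero_mul])
    rw [hc, zero_smul]

theorem smul_ghostPath_eq_zero_of_ghost_mul {c : K} {f : E} {b : List E}
    (h : ghost K Γ f * (c • ghostPath K Γ (Γ.s f) b) = 0) :
    c • ghostPath K Γ (Γ.s f) b = 0 := by
  rcases ghostPath_eq_zero_or_exists_mul_eq (K := K) (Γ := Γ) (Γ.s f) b with h0 | ⟨t, ht⟩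
  · rw [h0, smul_zero]
  · have hr : c • vertex K Γ (Γ.r f) = 0 := by
      rw [← (isLeavittFamily K Γ).ghost_edge, ← (isLeavittFamily K Γ).source_edge, ← ht,
        ← mul_assoc, ← mul_assoc, ← smul_mul_assoc, ← smul_mul_assoc, ← mul_smul_comm, h,
        zero_mul, zero_mul]
    have hc : c = 0 := eq_zero_of_map_smul_vertex hφ (by rw [hr, map_zero])
    rw [hc, zero_smul]

theorem vertex_mul_eq_zero_of_eventually {z : LeavittPathAlgebra K Γ} (hz : φ z = 0)
    (hghost : ∀ f, ghost K Γ f * z = 0) {x : V} {b : List E} {c : K}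
    (hc : ∀ᶠ F in atTop, edgeProjection K Γ F *
      (vertex K Γ x * z - c • ghostPath K Γ x b) = vertex K Γ x * z - c • ghostPath K Γ x b) :
    vertex K Γ x * z = 0 := by
  classical
  set m := ghostPath K Γ x b with hm
  have hghost' (f : E) : ghost K Γ f * (vertex K Γ x * z) = 0 := by
    rcases eq_or_ne (Γ.s f) x with rfl | h
    · rw [← mul_assoc, (isLeavittFamily K Γ).ghost_source, hghost]
    · rw [← mul_assoc, ghost_mul_vertex_of_ne h, zero_mul]
  have hkey : ∀ᶠ F in atTop, vertex K Γ x * z = c • m - edgeProjection K Γ F * (c • m) := by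
    filter_upwards [hc] with F hF
    rw [mul_sub, edgeProjection_mul_eq_zero F hghost', zero_sub] at hF
    rw [sub_eq_add_neg, hF, add_sub_cancel]
  suffices hcm : c • m = 0 ∨ vertex K Γ x * z = 0 by
    rcases hcm with hcm | hz
    · obtain ⟨F, hF⟩ := hkey.exists
      rw [hF, hcm, mul_zero, sub_zero]
    · exact hz
  by_cases hfin : {f | Γ.s f = x}.Finite
  · obtain ⟨F, hF, hle⟩ := (hkey.and (eventually_ge_atTop hfin.toFinset)).exists
    have hsub : {f | Γ.s f = x} ⊆ (F : Set E) := fun f hf => hle (hfin.mem_toFinset.2 hf)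
    rw [hm, ← vertex_mul_ghostPath_self, mul_smul_comm, ← mul_assoc, ← hm] at hF
    rcases edgeProjection_mul_vertex_of_subset (K := K) (Γ := Γ) hsub with h | h
    · exact Or.inr (by rw [hF, h, sub_self])
    · refine Or.inl (smul_ghostPath_eq_zero_of_map hφ ?_)
      rw [h, zero_mul, smul_zero, sub_zero, hm, vertex_mul_ghostPath_self] at hF
      rw [← hF, map_mul, hz, mul_zero]
  · obtain ⟨F, hF⟩ := hkey.exists
    obtain ⟨f, rfl, hfF⟩ := Set.Infinite.exists_notMem_finset hfin F
    refine Or.inl (smul_ghostPath_eq_zero_of_ghost_mul hφ ?_)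
    have h := hghost' f
    rwa [hF, mul_sub, ← mul_assoc, ghost_mul_edgeProjection_of_notMem hfF, zero_mul,
      sub_zero] at h

theorem eq_zero_of_mem_degreeFiltration {g : FreeGroup E} {n : ℕ} {z : LeavittPathAlgebra K Γ}
    (hz : z ∈ degreeFiltration K Γ g n) (h0 : φ z = 0) : z = 0 := by
  induction n generalizing g z with
  | zero =>
    obtain ⟨b, hb⟩ := exists_forall_pathElt_inv_eq g
    refine eq_zero_of_vertex_mul_eq_zero fun x => ?_
    obtain ⟨c, hc⟩ := exists_vertex_mul_eq_smul hz hb x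
    rw [hc]
    exact smul_ghostPath_eq_zero_of_map hφ (by rw [← hc, map_mul, h0, mul_zero])
  | succ n ih =>
    obtain ⟨b, hb⟩ := exists_forall_pathElt_inv_eq g
    have hghost (f : E) : ghost K Γ f * z = 0 :=
      ih (ghost_mul_mem_degreeFiltration f hz) (by rw [map_mul, h0, mul_zero])
    refine eq_zero_of_vertex_mul_eq_zero fun x => ?_
    obtain ⟨c, hc⟩ := exists_eventually_edgeProjection_mul hz hb x
    exact vertex_mul_eq_zero_of_eventually hφ h0 hghost hc

end

theorem injective_of_graded {A : FreeGroup E → Submodule K B} (hA : iSupIndep A)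
    (hmul : ∀ g h, ∀ x ∈ A g, ∀ y ∈ A h, x * y ∈ A (g * h))
    (hv : ∀ x, φ (vertex K Γ x) ∈ A 1) (he : ∀ f, φ (edge K Γ f) ∈ A (FreeGroup.of f))
    (hg : ∀ f, φ (ghost K Γ f) ∈ A (FreeGroup.of f)⁻¹) (hφ : ∀ x, φ (vertex K Γ x) ≠ 0) :
    Function.Injective φ := by
  have hghostPath (x : V) (b : List E) : φ (ghostPath K Γ x b) ∈ A (pathElt b)⁻¹ := by
    induction b with
    | nil => rw [ghostPath, pathElt_nil, inv_one]; exact hv x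
    | cons f b ih =>
      rw [ghostPath, map_mul, pathElt_cons, mul_inv_rev]
      exact hmul _ _ _ ih _ (hg f)
  have hmonomial (a : List E) (x : V) (b : List E) :
      φ (monomial K Γ a x b) ∈ A (pathElt a * (pathElt b)⁻¹) := by
    induction a with
    | nil => rw [monomial, pathElt_nil, one_mul]; exact hghostPath x b
    | cons f a ih =>
      rw [monomial, map_mul, pathElt_cons, mul_assoc]
      exact hmul _ _ _ (he f) _ ih
  have hmap (g : FreeGroup E) (n : ℕ) :
      degreeFiltration K Γ g n ≤ (A g).comap (φ : LeavittPathAlgebra K Γ →ₗ[K] B) := by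
    refine Submodule.span_le.2 ?_
    rintro _ ⟨a, x, b, -, rfl, rfl⟩
    exact hmonomial a x b
  refine injective_of_iSupIndep (φ : LeavittPathAlgebra K Γ →ₗ[K] B) iSup_degreeFiltration hA
    (fun g z hz => iSup_le (hmap g) hz) fun g z hz h0 => ?_
  obtain ⟨n, hn⟩ :=
    (Submodule.mem_iSup_of_directed _ (degreeFiltration_mono g).directed_le).1 hz
  exact eq_zero_of_mem_degreeFiltration hφ hn h0

end LeavittPathAlgebra

open PartialAction.SkewGroupRing

variable {K : Type w} [Field K] {Γ : DirectedGraph V E}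

/-! ### The canonical isomorphism -/

theorem vertexDelta_ne_zero (x : V) : vertexDelta K Γ x ≠ 0 := by
  rw [vertexDelta_eq_charDelta]
  exact charDelta_ne_zero (BoundaryPath.exists_source_eq Γ x)

theorem char_domain_mul {g : FreeGroup E} {r : DX K Γ} (hr : r ∈ idealD K Γ g) :
    char K Γ (Γ.domain g) * r.1 = r.1 := by
  funext η
  by_cases hη : η ∈ Γ.domain g
  · rw [Pi.mul_apply, char_of_mem hη, one_mul]
  · rw [Pi.mul_apply, mem_idealD_iff.1 hr η hη, mul_zero]

theorem oneDelta_mul_oneDelta {g h : FreeGroup E} (hg : g ≠ 1) (hh : h ≠ 1) (hgh : g * h ≠ 1)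
    (hsub : Γ.domain (g * h) ⊆ Γ.domain g) :
    oneDelta K Γ g hg * oneDelta K Γ h hh = oneDelta K Γ (g * h) hgh := by
  simp only [oneDelta_eq_charDelta]
  refine charDelta_mul_charDelta rfl fun η => ⟨fun hη => ⟨hsub hη, ?_⟩, ?_⟩
  · obtain ⟨ξ, hξ⟩ := mem_domain_iff.1 (hsub hη)
    exact ⟨ξ, hξ.mem_domain_mul_iff.1 hη, hξ⟩
  · rintro ⟨-, ξ, hξ, hξη⟩
    exact hξη.mem_domain_mul_iff.2 hξ

open Classical in
theorem domain_mk_append_subset {w w' : List (E × Bool)} (h : FreeGroup.IsReduced (w ++ w')) :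
    Γ.domain (FreeGroup.mk (w ++ w')) ⊆ Γ.domain (FreeGroup.mk w) := by
  intro η hη
  obtain ⟨ξ, hξ⟩ := mem_domain_iff.1 hη
  rw [theta_iff_actRel, FreeGroup.toWord_mk, h.reduce_eq] at hξ
  obtain ⟨ζ, -, hζ⟩ := actRel_append.1 hξ
  refine mem_domain_iff.2 ⟨ζ, ?_⟩
  rwa [theta_iff_actRel, FreeGroup.toWord_mk, (h.infix ⟨[], w', rfl⟩).reduce_eq]

section Generation

variable {S : NonUnitalSubalgebra K (SkewRing K Γ)}
  (hedge : ∀ f, oneDelta K Γ (FreeGroup.of f) (FreeGroup.of_ne_one f) ∈ S)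
  (hghost : ∀ f, oneDelta K Γ (FreeGroup.of f)⁻¹ (inv_ne_one.2 (FreeGroup.of_ne_one f)) ∈ S)

include hedge hghost

theorem oneDelta_mk_mem {w : List (E × Bool)} (hw : FreeGroup.IsReduced w)
    (h : FreeGroup.mk w ≠ 1) : oneDelta K Γ (FreeGroup.mk w) h ∈ S := by
  induction w with
  | nil => exact absurd rfl h
  | cons l w ih =>
    obtain ⟨hl, hlS⟩ : ∃ hl, oneDelta K Γ (FreeGroup.mk [l]) hl ∈ S := by
      obtain ⟨f, _ | _⟩ := l
      exacts [⟨_, hghost f⟩, ⟨_, hedge f⟩]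
    have hmul : FreeGroup.mk (l :: w) = FreeGroup.mk [l] * FreeGroup.mk w :=
      (FreeGroup.mul_mk (L₁ := [l])).symm
    by_cases hw1 : FreeGroup.mk w = 1
    · simpa only [hmul, hw1, mul_one] using hlS
    · have hsub : Γ.domain (FreeGroup.mk [l] * FreeGroup.mk w) ⊆ Γ.domain (FreeGroup.mk [l]) :=
        hmul ▸ domain_mk_append_subset (w := [l]) hw
      simp only [hmul] at h ⊢
      rw [← oneDelta_mul_oneDelta hl hw1 h hsub]
      exact mul_mem hlS (ih (hw.infix ⟨[l], [], by simp only [List.append_nil]; rfl⟩) hw1)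

theorem oneDelta_mem {g : FreeGroup E} (hg : g ≠ 1) : oneDelta K Γ g hg ∈ S := by
  classical
  simpa only [FreeGroup.mk_toWord] using
    oneDelta_mk_mem hedge hghost FreeGroup.isReduced_toWord (w := g.toWord)
      (by rwa [FreeGroup.mk_toWord])

theorem deltaOne_mem (hvertex : ∀ x, vertexDelta K Γ x ∈ S) (r : DX K Γ) : deltaOne r ∈ S := by
  obtain ⟨F, hF⟩ := r
  change F ∈ Submodule.span K (spanningSet K Γ) at hF
  induction hF using Submodule.span_induction with
  | zero => exact (map_zero (deltaOne (K := K) (Γ := Γ))).symm ▸ zero_mem S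
  | add F F' h h' ih ih' =>
    exact (map_add deltaOne (⟨F, h⟩ : DX K Γ) ⟨F', h'⟩).symm ▸ add_mem ih ih'
  | smul k F h ih => exact (map_smul deltaOne k (⟨F, h⟩ : DX K Γ)).symm ▸ S.smul_mem k ih
  | mem F hF =>
    rcases hF with ⟨g, hg, rfl⟩ | ⟨x, rfl⟩
    · exact oneDelta_mul_oneDelta_inv K hg ▸
        mul_mem (oneDelta_mem hedge hghost hg) (oneDelta_mem hedge hghost (inv_ne_one.2 hg))
    · exact hvertex x

theorem eq_top_of_generators_mem (hvertex : ∀ x, vertexDelta K Γ x ∈ S) : S = ⊤ := by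
  refine eq_top_iff.2 fun z _ => ?_
  induction z using PartialAction.SkewGroupRing.induction_on with
  | h0 => exact zero_mem S
  | hadd a b ha hb => exact add_mem (ha trivial) (hb trivial)
  | hsingle g r =>
    have hr := deltaOne_mem hedge hghost hvertex r.1
    by_cases hg : g = 1
    · subst hg
      exact hr
    · have hmul : deltaOne r.1 * oneDelta K Γ g hg = single (freeGroupAction K Γ) g r := by
        exact (deltaOne_mul_single _ _).trans
          (single_congr rfl ((mul_comm _ _).trans (char_domain_mul r.2)))
      exact hmul ▸ mul_mem hr (oneDelta_mem hedge hghost hg)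

end Generation

section CanonicalIso

variable (K Γ) in
/-- The canonical homomorphism from the Leavitt path algebra to the partial skew group ring. -/
noncomputable def toSkewRing : LeavittPathAlgebra K Γ →ₙₐ[K] SkewRing K Γ :=
  (isLeavittFamily_skewRing K Γ).lift K

theorem toSkewRing_vertex (x : V) :
    toSkewRing K Γ (LeavittPathAlgebra.vertex K Γ x) = vertexDelta K Γ x :=
  (isLeavittFamily_skewRing K Γ).lift_vertex x

theorem toSkewRing_edge (f : E) : toSkewRing K Γ (LeavittPathAlgebra.edge K Γ f) =
    oneDelta K Γ (FreeGroup.of f) (FreeGroup.of_ne_one f) :=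
  (isLeavittFamily_skewRing K Γ).lift_edge f

theorem toSkewRing_ghost (f : E) : toSkewRing K Γ (LeavittPathAlgebra.ghost K Γ f) =
    oneDelta K Γ (FreeGroup.of f)⁻¹ (inv_ne_one.2 (FreeGroup.of_ne_one f)) :=
  (isLeavittFamily_skewRing K Γ).lift_ghost f

theorem toSkewRing_injective : Function.Injective (toSkewRing K Γ) := by
  refine LeavittPathAlgebra.injective_of_graded (iSupIndep_component (freeGroupAction K Γ))
    (fun _ _ _ ha _ hb => component_mul_component _ ha hb) (fun x => ?_) (fun f => ?_)
    (fun f => ?_) fun x => ?_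
  · exact ⟨_, (toSkewRing_vertex x).symm⟩
  · exact ⟨_, (toSkewRing_edge f).symm⟩
  · exact ⟨_, (toSkewRing_ghost f).symm⟩
  · exact toSkewRing_vertex (K := K) x ▸ vertexDelta_ne_zero x

theorem toSkewRing_surjective : Function.Surjective (toSkewRing K Γ) := by
  have htop : NonUnitalAlgHom.range (toSkewRing K Γ) = ⊤ := by
    refine eq_top_of_generators_mem ?_ ?_ ?_ <;> simp only [NonUnitalAlgHom.mem_range]
    exacts [fun f => ⟨_, toSkewRing_edge f⟩, fun f => ⟨_, toSkewRing_ghost f⟩,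
      fun x => ⟨_, toSkewRing_vertex x⟩]
  exact fun z => (NonUnitalAlgHom.mem_range _).1 (htop ▸ NonUnitalAlgebra.mem_top)

theorem isCanonicalIso_toSkewRing : IsCanonicalIso (toSkewRing K Γ) where
  bijective := ⟨toSkewRing_injective, toSkewRing_surjective⟩
  edge := toSkewRing_edge
  ghost := toSkewRing_ghost
  vertex := toSkewRing_vertex

theorem isGrading_component : GroupGraded.IsGrading fun g =>
    (component (freeGroupAction K Γ) g).toAddSubgroup where
  internal := isInternal_component _
  mul_mem _ _ _ _ := component_mul_component _

variable {φ : LeavittPathAlgebra K Γ →ₙₐ[K] SkewRing K Γ}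

/-- A canonical isomorphism as an isomorphism of rings. -/
noncomputable def IsCanonicalIso.ringEquiv (hφ : IsCanonicalIso φ) :
    LeavittPathAlgebra K Γ ≃+* SkewRing K Γ :=
  RingEquiv.ofBijective (φ : LeavittPathAlgebra K Γ →ₙ+* SkewRing K Γ) hφ.bijective

theorem IsCanonicalIso.isGrading (hφ : IsCanonicalIso φ) :
    GroupGraded.IsGrading (inducedGrading φ) :=
  isGrading_component.comap hφ.ringEquiv

end CanonicalIso

open GroupGraded

/-! ### Strongly graded, graded clean and graded unit-regular -/

theorem deltaOne_char_domain_mul {g : FreeGroup E} (hg : g ≠ 1) {a : SkewRing K Γ}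
    (ha : a ∈ component (freeGroupAction K Γ) g) :
    deltaOne ⟨_, char_domain_mem K Γ hg⟩ * a = a := by
  obtain ⟨r, rfl⟩ := ha
  exact (deltaOne_mul_single _ r).trans (single_congr rfl (char_domain_mul r.2))

theorem mem_domain_of_deltaOne_mul_vertexDelta {g : FreeGroup E} (hg : g ≠ 1)
    {ξ : BoundaryPath Γ} (h : deltaOne ⟨_, char_domain_mem K Γ hg⟩ * vertexDelta K Γ ξ.source =
      vertexDelta K Γ ξ.source) : ξ ∈ Γ.domain g := by
  have hchar : char K Γ (Γ.domain g) * char K Γ (Γ.vertexSet ξ.source) =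
      char K Γ (Γ.vertexSet ξ.source) :=
    congrArg (fun r : (freeGroupAction K Γ).D 1 => r.1.1)
      (single_injective _ 1 ((deltaOne_mul_single _ _).symm.trans h))
  have hξ := congrFun hchar ξ
  by_contra hξg
  rw [Pi.mul_apply, char_of_notMem hξg, zero_mul,
    char_of_mem (show ξ ∈ Γ.vertexSet ξ.source from rfl)] at hξ
  exact zero_ne_one hξ

theorem isLoop_of_domain_eq_univ {f : E} (h : Γ.domain (FreeGroup.of f) = Set.univ)
    (h' : Γ.domain (FreeGroup.of f)⁻¹ = Set.univ) : Γ.IsLoop := by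
  have hV (y : V) : y = Γ.r f := by
    obtain ⟨ξ, rfl⟩ := BoundaryPath.exists_source_eq Γ y
    exact mem_domain_of_inv.1 (h' ▸ Set.mem_univ ξ)
  refine ⟨Γ.r f, f, hV, fun f' => ?_, hV _, rfl⟩
  obtain ⟨ξ, hξ⟩ := BoundaryPath.exists_source_eq Γ (Γ.r f')
  obtain ⟨η, hη⟩ := BoundaryPath.exists_isCons hξ
  obtain ⟨ζ, hζ⟩ := mem_domain_of.1 (h ▸ Set.mem_univ η)
  exact (hη.inj hζ).1

variable {φ : LeavittPathAlgebra K Γ →ₙₐ[K] SkewRing K Γ}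

namespace IsCanonicalIso

/-- The idempotent `1_g δ_1` acts as a left identity on `D_g δ_g`, and it fixes all the vertices
only if `X_g = X`. -/
theorem domain_eq_univ (hφ : IsCanonicalIso φ) {g : FreeGroup E} (hg : g ≠ 1)
    (hvertex : ∀ x, LeavittPathAlgebra.vertex K Γ x ∈
      AddSubgroup.closure {z | ∃ a ∈ inducedGrading φ g, ∃ b, z = a * b}) :
    Γ.domain g = Set.univ := by
  have hfix {z : LeavittPathAlgebra K Γ}
      (hz : z ∈ AddSubgroup.closure {z | ∃ a ∈ inducedGrading φ g, ∃ b, z = a * b}) :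
      deltaOne ⟨_, char_domain_mem K Γ hg⟩ * φ z = φ z := by
    induction hz using AddSubgroup.closure_induction with
    | mem z hz =>
      obtain ⟨a, ha, b, rfl⟩ := hz
      rw [map_mul, ← mul_assoc, deltaOne_char_domain_mul hg (a := φ a) ha]
    | zero => rw [map_zero, mul_zero]
    | add a b _ _ ha hb => rw [map_add, mul_add, ha, hb]
    | neg a _ ha => rw [map_neg, mul_neg, ha]
  refine Set.eq_univ_of_forall fun ξ => mem_domain_of_deltaOne_mul_vertexDelta (K := K) hg ?_
  rw [← hφ.vertex]
  exact hfix (hvertex _)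

theorem domain_eq_univ_of_isInvertible (hφ : IsCanonicalIso φ) {e u : LeavittPathAlgebra K Γ}
    (he : IsUnity e) (hu : IsInvertible e u) {g : FreeGroup E} (hg : g ≠ 1)
    (hgu : u ∈ inducedGrading φ g) : Γ.domain g = Set.univ := by
  obtain ⟨w, huw, -⟩ := hu
  exact hφ.domain_eq_univ hg fun x => AddSubgroup.subset_closure
    ⟨u, hgu, w * LeavittPathAlgebra.vertex K Γ x, by rw [← mul_assoc, huw, (he _).1]⟩

theorem vertex_ne_zero (hφ : IsCanonicalIso φ) (x : V) :
    LeavittPathAlgebra.vertex K Γ x ≠ 0 := fun h =>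
  vertexDelta_ne_zero (K := K) x (by rw [← hφ.vertex, h, map_zero])

theorem vertex_mem (hφ : IsCanonicalIso φ) (x : V) :
    LeavittPathAlgebra.vertex K Γ x ∈ inducedGrading φ 1 := ⟨_, (hφ.vertex x).symm⟩

theorem edge_mem (hφ : IsCanonicalIso φ) (f : E) :
    LeavittPathAlgebra.edge K Γ f ∈ inducedGrading φ (FreeGroup.of f) := ⟨_, (hφ.edge f).symm⟩

theorem ghost_mem (hφ : IsCanonicalIso φ) (f : E) :
    LeavittPathAlgebra.ghost K Γ f ∈ inducedGrading φ (FreeGroup.of f)⁻¹ :=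
  ⟨_, (hφ.ghost f).symm⟩

theorem edge_ne_zero (hφ : IsCanonicalIso φ) (f : E) : LeavittPathAlgebra.edge K Γ f ≠ 0 :=
  fun h => hφ.vertex_ne_zero (Γ.r f) (by
    rw [← (LeavittPathAlgebra.isLeavittFamily K Γ).ghost_edge, h, mul_zero])

theorem ghost_ne_zero (hφ : IsCanonicalIso φ) (f : E) : LeavittPathAlgebra.ghost K Γ f ≠ 0 :=
  fun h => hφ.vertex_ne_zero (Γ.r f) (by
    rw [← (LeavittPathAlgebra.isLeavittFamily K Γ).ghost_edge, h, zero_mul])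

theorem isLoop_of_isStronglyGraded [Nonempty E] (hφ : IsCanonicalIso φ)
    (h : IsStronglyGraded (inducedGrading φ)) : Γ.IsLoop := by
  have hdomain {g : FreeGroup E} (hg : g ≠ 1) : Γ.domain g = Set.univ := by
    refine hφ.domain_eq_univ hg fun x => ?_
    have hx := hφ.vertex_mem x
    rw [← mul_inv_cancel g, ← h.2] at hx
    refine AddSubgroup.closure_mono ?_ hx
    rintro _ ⟨a, ha, b, -, hz⟩
    exact ⟨a, ha, b, hz⟩
  obtain ⟨f⟩ := ‹Nonempty E›
  exact isLoop_of_domain_eq_univ (hdomain (FreeGroup.of_ne_one f))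
    (hdomain (inv_ne_one.2 (FreeGroup.of_ne_one f)))

theorem isLoop_of_isGradedClean [Nonempty E] (hφ : IsCanonicalIso φ)
    (h : IsGradedClean (inducedGrading φ)) : Γ.IsLoop := by
  obtain ⟨e, he, hinv⟩ := h.exists_isInvertible
  have hdomain {g : FreeGroup E} (hg : g ≠ 1) {x : LeavittPathAlgebra K Γ}
      (hx : x ∈ inducedGrading φ g) (hx0 : x ≠ 0) : Γ.domain g = Set.univ :=
    hφ.domain_eq_univ_of_isInvertible he (hinv g hg x hx hx0) hg hx
  obtain ⟨f⟩ := ‹Nonempty E›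
  exact isLoop_of_domain_eq_univ
    (hdomain (FreeGroup.of_ne_one f) (hφ.edge_mem f) (hφ.edge_ne_zero f))
    (hdomain (inv_ne_one.2 (FreeGroup.of_ne_one f)) (hφ.ghost_mem f) (hφ.ghost_ne_zero f))

theorem isLoop_of_isGradedUnitRegular [Nonempty E] (hφ : IsCanonicalIso φ)
    (h : IsGradedUnitRegular (inducedGrading φ)) : Γ.IsLoop := by
  obtain ⟨e, he, hinv⟩ := h.exists_isInvertible
  have hdomain {g : FreeGroup E} (hg : g ≠ 1) {x : LeavittPathAlgebra K Γ}
      (hx : x ∈ inducedGrading φ g⁻¹) (hx0 : x ≠ 0) : Γ.domain g = Set.univ := by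
    obtain ⟨u, hu, hue⟩ := hinv _ x hx hx0
    exact hφ.domain_eq_univ_of_isInvertible he hue hg (inv_inv g ▸ hu)
  obtain ⟨f⟩ := ‹Nonempty E›
  exact isLoop_of_domain_eq_univ
    (hdomain (FreeGroup.of_ne_one f) (hφ.ghost_mem f) (hφ.ghost_ne_zero f))
    (hdomain (inv_ne_one.2 (FreeGroup.of_ne_one f))
      ((inv_inv (FreeGroup.of f)).symm ▸ hφ.edge_mem f) (hφ.edge_ne_zero f))

end IsCanonicalIso

namespace IsLoop

theorem subsingleton (h : Γ.IsLoop) : Subsingleton (BoundaryPath Γ) := by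
  obtain ⟨x, e, hV, hE, hs, -⟩ := h
  have hsink (y : V) : ¬Γ.IsSink y := fun hy => hy e (hs.trans (hV y).symm)
  refine ⟨fun ξ η => ?_⟩
  cases ξ with
  | finite y a hy =>
    obtain ⟨z, hz, -⟩ := hy
    exact absurd hz (hsink z)
  | infinite p hp =>
    cases η with
    | finite y a hy =>
      obtain ⟨z, hz, -⟩ := hy
      exact absurd hz (hsink z)
    | infinite q hq =>
      congr 1
      funext n
      rw [hE (p n), hE (q n)]

theorem theta_self (h : Γ.IsLoop) (g : FreeGroup E) (ξ : BoundaryPath Γ) : Γ.Theta g ξ ξ := by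
  have hX := h.subsingleton
  obtain ⟨x, e, hV, -⟩ := h
  have hof (f : E) : Γ.Theta (FreeGroup.of f) ξ ξ := by
    obtain ⟨η, hη⟩ := BoundaryPath.exists_isCons (f := f) (ξ := ξ) ((hV _).trans (hV _).symm)
    exact theta_of.2 (Subsingleton.elim η ξ ▸ hη)
  induction g with
  | C1 => exact theta_one.2 rfl
  | of f => exact hof f
  | inv_of f _ => exact (hof f).inv
  | mul g h hg hh => exact hh.trans hg

theorem char_univ_mem (h : Γ.IsLoop) : char K Γ Set.univ ∈ DX K Γ := by
  obtain ⟨x, e, hV, -⟩ := h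
  have huniv : Γ.vertexSet x = Set.univ := Set.eq_univ_of_forall fun ξ => hV ξ.source
  exact huniv ▸ char_vertexSet_mem K Γ x

variable (K) in
/-- The element `1 δ_g`, which spans `D_g δ_g` when the graph is a single loop. -/
noncomputable def unitDelta (h : Γ.IsLoop) (g : FreeGroup E) : SkewRing K Γ :=
  charDelta K g Set.univ h.char_univ_mem fun ξ _ => mem_domain_iff.2 ⟨ξ, h.theta_self g ξ⟩

theorem unitDelta_mul_unitDelta (h : Γ.IsLoop) (g g' : FreeGroup E) :
    h.unitDelta K g * h.unitDelta K g' = h.unitDelta K (g * g') :=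
  charDelta_mul_charDelta rfl fun η =>
    ⟨fun _ => ⟨trivial, η, trivial, h.theta_self g η⟩, fun _ => trivial⟩

theorem nonempty_boundaryPath (h : Γ.IsLoop) : Nonempty (BoundaryPath Γ) := by
  obtain ⟨x, -⟩ := h
  exact (BoundaryPath.exists_source_eq Γ x).nonempty

theorem exists_single_eq_smul (h : Γ.IsLoop) {g : FreeGroup E} (r : (freeGroupAction K Γ).D g) :
    ∃ c : K, single (freeGroupAction K Γ) g r = c • h.unitDelta K g := by
  have hX := h.subsingleton
  obtain ⟨ξ⟩ := h.nonempty_boundaryPath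
  refine ⟨r.1.1 ξ, (single_congr rfl (funext fun η => ?_)).trans (map_smul _ _ _)⟩
  change r.1.1 η = r.1.1 ξ * char K Γ Set.univ η
  rw [char_of_mem (Set.mem_univ η), mul_one, Subsingleton.elim η ξ]

theorem isUnity_unitDelta_one (h : Γ.IsLoop) : IsUnity (h.unitDelta K 1) := by
  intro z
  induction z using PartialAction.SkewGroupRing.induction_on with
  | h0 => exact ⟨mul_zero _, zero_mul _⟩
  | hadd a b ha hb => exact ⟨by rw [mul_add, ha.1, hb.1], by rw [add_mul, ha.2, hb.2]⟩
  | hsingle g r =>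
    obtain ⟨c, hc⟩ := h.exists_single_eq_smul r
    rw [hc, mul_smul_comm, smul_mul_assoc, unitDelta_mul_unitDelta, unitDelta_mul_unitDelta,
      one_mul, mul_one]
    exact ⟨rfl, rfl⟩

theorem isFullGradedDivision_component (h : Γ.IsLoop) :
    IsFullGradedDivision fun g => (component (freeGroupAction K Γ) g).toAddSubgroup where
  isGrading := isGrading_component
  exists_ne_zero g := by
    have := h.nonempty_boundaryPath
    exact ⟨h.unitDelta K g, charDelta_mem_component, charDelta_ne_zero Set.univ_nonempty⟩
  exists_inverse := by
    refine ⟨h.unitDelta K 1, h.isUnity_unitDelta_one, ?_⟩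
    rintro g _ ⟨r, rfl⟩ hr
    obtain ⟨c, hc⟩ := h.exists_single_eq_smul r
    rw [hc] at hr ⊢
    have hc0 : c ≠ 0 := left_ne_zero_of_smul hr
    refine ⟨c⁻¹ • h.unitDelta K g⁻¹,
      (component (freeGroupAction K Γ) g⁻¹).smul_mem c⁻¹ charDelta_mem_component, ?_⟩
    simp only [smul_mul_smul_comm, unitDelta_mul_unitDelta, mul_inv_cancel, inv_mul_cancel,
      mul_inv_cancel₀ hc0, inv_mul_cancel₀ hc0, one_smul, and_self]

end IsLoop

theorem IsCanonicalIso.isFullGradedDivision (hφ : IsCanonicalIso φ) (h : Γ.IsLoop) :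
    IsFullGradedDivision (inducedGrading φ) :=
  h.isFullGradedDivision_component.comap hφ.ringEquiv

end DirectedGraph

theorem theorem3p7 {V : Type u} {E : Type v} [Nonempty E] (K : Type w) [Field K]
    (Γ : DirectedGraph V E) :
    ∃ φ : Γ.LeavittPathAlgebra K →ₙₐ[K] Γ.SkewRing K,
      DirectedGraph.IsCanonicalIso φ ∧ (∀ ψ, DirectedGraph.IsCanonicalIso ψ → ψ = φ) ∧
      GroupGraded.IsGrading (DirectedGraph.inducedGrading φ) ∧
      List.TFAE [
        GroupGraded.IsStronglyGraded (DirectedGraph.inducedGrading φ),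
        GroupGraded.IsGradedClean (DirectedGraph.inducedGrading φ),
        GroupGraded.IsGradedUnitRegular (DirectedGraph.inducedGrading φ),
        Γ.IsLoop] := by
  have hφ := DirectedGraph.isCanonicalIso_toSkewRing (K := K) (Γ := Γ)
  refine ⟨DirectedGraph.toSkewRing K Γ, hφ, fun ψ hψ => ?_, hφ.isGrading, ?_⟩
  · exact DirectedGraph.LeavittPathAlgebra.hom_ext
      (fun x => (hψ.vertex x).trans (hφ.vertex x).symm)
      (fun f => (hψ.edge f).trans (hφ.edge f).symm)
      (fun f => (hψ.ghost f).trans (hφ.ghost f).symm)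
  · tfae_have 1 → 4 := hφ.isLoop_of_isStronglyGraded
    tfae_have 2 → 4 := hφ.isLoop_of_isGradedClean
    tfae_have 3 → 4 := hφ.isLoop_of_isGradedUnitRegular
    tfae_have 4 → 1 := fun h => (hφ.isFullGradedDivision h).isStronglyGraded
    tfae_have 4 → 2 := fun h => (hφ.isFullGradedDivision h).isGradedClean
    tfae_have 4 → 3 := fun h => (hφ.isFullGradedDivision h).isGradedUnitRegular
    tfae_finish
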